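/- Let $\mathbb X$ be a Polish space, $\nu$ a nonatomic probability measure on $\mathbb X$, $\alpha\in(0,1)$, $\theta>-\alpha$, and let $(X_i)_{i\ge 1}$ be a sequence from the Ewens--Pitman sampling model: $X_1\sim\nu$ and, for every $i\ge 1$, $$\mathbb P[X_{i+1}\in\cdot\mid X_1,\dots,X_i]=\frac{\theta+j\alpha}{\theta+i}\,\nu(\cdot)+\frac1{\theta+i}\sum_{k=1}^{j}(n_k-\alpha)\,\delta_{X_k^*}(\cdot),$$ where $X_1^*,\dots,X_j^*$ are the distinct values of $X_1,\dots,X_i$ and $n_1,\dots,n_j$ their frequencies. Let $K_n$ be the number of distinct values (blocks) in $(X_1,\dots,X_n)$ and $\mathbf N_n=(N_1,\dots,N_{K_n})$ their frequencies, in order of appearance. For $l\ge 1$ let $M_{l,m}^{(n)}$ be the number of blocks with frequency $l$ in the enlarged sample $(X_1,\dots,X_{n+m})$. Let $(x)_{(k)}=x(x+1)\cdots(x+k-1)$, with $(x)_{(0)}=1$, and define $$h_1(\lambda)=\lambda+\log\frac{e^\lambda-1}{e^\lambda}+\log\frac{\alpha(1-\alpha)_{(l-1)}}{\alpha^\alpha\,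 l!}\quad(\lambda>0),$$ $$h_2(\varepsilon)=l\log\frac{1-(l-\alpha)\varepsilon}{1-l\varepsilon}+\alpha\log\frac{\varepsilon}{1-(l-\alpha)\varepsilon}\quad(0<\varepsilon<1/l),$$ where $h_2$ is an increasing bijection from $(0,1/l)$ onto $\mathbb R$. Set $\Lambda_{\alpha,l}(\lambda)=0$ for $\lambda\le 0$, $$\Lambda_{\alpha,l}(\lambda)=\log\left(1+\frac{\alpha\,h_2^{-1}(h_1(\lambda))}{1-l\,h_2^{-1}(h_1(\lambda))}\right)\quad\text{for }\lambda>0,\qquad I_l^\alpha(x)=\sup_{\lambda\in\mathbb R}\{\lambda x-\Lambda_{\alpha,l}(\lambda)\}\quad(x\in\mathbb R).$$ Then for all $l\ge1$ and $n\ge 1$, and all positive integers $n_1,\dots,n_j$ with sum $n$, writing $\mathbf n=(n_1,\dots,n_j)$, the event $\{K_n=j,\ \mathbf N_n=\mathbf n\}$ has positive probability and, conditionally on it, $m^{-1}M_{l,m}^{(n)}$ satisfies, as $m\to\infty$, a large deviation principle on $\mathbb R$ with speed $m$ and good rate function $I_l^\alpha$. In particular, for Lebesgue-almost all $x>0$,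 $$\lim_{m\to\infty}\frac1m\log\mathbb P\left[\frac{M_{l,m}^{(n)}}m>x\ \Big|\ K_n=j,\ \mathbf N_n=\mathbf n\right]=-I_l^\alpha(x)\qquad(\text{with }\log 0=-\infty).$$ Moreover $I_l^\alpha(0)=0$, $I_l^\alpha(x)<+\infty$ for $x\in(0,1/l]$, and $I_l^\alpha(x)=+\infty$ for $x\notin[0,1/l]$. -/

import Mathlib

open MeasureTheory ProbabilityTheory Filter Topology

/-! ## The partition induced by the first `n` terms of a sequence

A sequence is indexed from `0`, so `x 0, …, x (n - 1)` is the sample of size `n`. -/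

open Classical in
/-- The set of distinct values among the first `n` terms. -/
noncomputable def distinctValues {S : Type*} (x : ℕ → S) (n : ℕ) : Finset S :=
  (Finset.range n).image x

open Classical in
/-- The number of times the value `y` occurs among the first `n` terms. -/
noncomputable def frequency {S : Type*} (x : ℕ → S) (n : ℕ) (y : S) : ℕ :=
  ((Finset.range n).filter (fun i => x i = y)).card

/-- `K_n`: the number of blocks (distinct values) among the first `n` terms. -/
noncomputable def numBlocks {S : Type*} (x : ℕ → S) (n : ℕ) : ℕ :=
  (distinctValues x n).card

open Classical in
/-- `𝐍_n = (N_1, …, N_{K_n})`: the block frequencies among the first `n` terms, the blocks being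
listed in order of appearance (the filter keeps the indices at which a new value appears). -/
noncomputable def blockFrequencies {S : Type*} (x : ℕ → S) (n : ℕ) : List ℕ :=
  ((List.range n).filter (fun i => ∀ k < i, x k ≠ x i)).map (fun i => frequency x n (x i))

open Classical in
/-- `M_{l,n}`: the number of blocks with frequency `l` among the first `n` terms. The number
`M_{l,m}^{(n)}` of blocks with frequency `l` in a sample of size `n` enlarged by `m` further draws
is `numBlocksWithFrequency x (n + m) l`. -/
noncomputable def numBlocksWithFrequency {S : Type*} (x : ℕ → S) (n l : ℕ) : ℕ :=
  ((distinctValues x n).filter (fun y => frequency x n y = l)).card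

/-! ## The Ewens-Pitman sampling model -/

/-- `X 0, X 1, …` (that is, `X_1, X_2, …`) is a sequence of draws from the Ewens-Pitman sampling
model with parameters `α`, `θ` and base distribution `ν`: `X_1` has law `ν`, and for every `i ≥ 1`
and every measurable `A`, almost surely
`P[X_{i+1} ∈ A | X_1, …, X_i] = (θ + jα)/(θ + i) ν(A) + 1/(θ + i) ∑ (n_k - α) δ_{X_k^*}(A)`,
the sum being over the `j` distinct values `X_k^*` of `X_1, …, X_i` with frequencies `n_k`. -/
structure IsEwensPitmanSample {S Ω : Type*} [MeasurableSpace S] [MeasurableSpace Ω]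
    (α θ : ℝ) (ν : Measure S) (P : Measure Ω) (X : ℕ → Ω → S) : Prop where
  measurable : ∀ i, Measurable (X i)
  law_first : P.map (X 0) = ν
  predictive : ∀ i : ℕ, 1 ≤ i → ∀ A : Set S, MeasurableSet A →
    P[(X i ⁻¹' A).indicator (fun _ => (1 : ℝ)) |
        MeasurableSpace.comap (fun ω (k : Fin i) => X k ω) MeasurableSpace.pi]
      =ᵐ[P] fun ω =>
        (θ + (numBlocks (fun k => X k ω) i : ℝ) * α) / (θ + i) * ν.real A
          + 1 / (θ + i) * ∑ y ∈ distinctValues (fun k => X k ω) i,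
              ((frequency (fun k => X k ω) i y : ℝ) - α) * A.indicator (fun _ => (1 : ℝ)) y

/-- The event `{K_n = j, 𝐍_n = (n_1, …, n_j)}`. -/
def initialEvent {S Ω : Type*} (X : ℕ → Ω → S) (n j : ℕ) (nn : Fin j → ℕ) : Set Ω :=
  {ω | numBlocks (fun k => X k ω) n = j ∧ blockFrequencies (fun k => X k ω) n = List.ofFn nn}

/-! ## Large deviation principles -/

/-- Under `Q`, the random elements `Z m` satisfy, as `m → ∞`, a large deviation principle with
speed `a m` and rate function `I` (lower semicontinuous, with values in `[0, ∞]`). -/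
structure SatisfiesLDP {Ω E : Type*} [MeasurableSpace Ω] [TopologicalSpace E]
    (Q : Measure Ω) (Z : ℕ → Ω → E) (a : ℕ → ℝ) (I : E → EReal) : Prop where
  nonneg : ∀ x, 0 ≤ I x
  lowerSemicontinuous : LowerSemicontinuous I
  upper_bound : ∀ F : Set E, IsClosed F →
    limsup (fun m => (((a m)⁻¹ : ℝ) : EReal) * ENNReal.log (Q {ω | Z m ω ∈ F})) atTop
      ≤ -(⨅ x ∈ F, I x)
  lower_bound : ∀ G : Set E, IsOpen G →
    -(⨅ x ∈ G, I x)
      ≤ liminf (fun m => (((a m)⁻¹ : ℝ) : EReal) * ENNReal.log (Q {ω | Z m ω ∈ G})) atTop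

/-! ## The rate function -/

/-- `h₁(λ) = λ + log ((e^λ - 1) / e^λ) + log (α (1 - α)_{(l - 1)} / (α^α l!))`, where
`(x)_{(n)} = x (x + 1) ⋯ (x + n - 1)`. -/
noncomputable def ldH₁ (α : ℝ) (l : ℕ) (t : ℝ) : ℝ :=
  t + Real.log ((Real.exp t - 1) / Real.exp t)
    + Real.log (α * (ascPochhammer ℝ (l - 1)).eval (1 - α) / (α ^ α * (l.factorial : ℝ)))

/-- `h₂(ε) = l log ((1 - (l - α) ε) / (1 - l ε)) + α log (ε / (1 - (l - α) ε))`. -/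
noncomputable def ldH₂ (α : ℝ) (l : ℕ) (ε : ℝ) : ℝ :=
  l * Real.log ((1 - (l - α) * ε) / (1 - l * ε)) + α * Real.log (ε / (1 - (l - α) * ε))

/-- `ε₀(λ) = h₂⁻¹ (h₁ (λ))`, the inverse being that of the increasing bijection
`h₂ : (0, 1/l) → ℝ`. -/
noncomputable def ldEps (α : ℝ) (l : ℕ) (t : ℝ) : ℝ :=
  Function.invFunOn (ldH₂ α l) (Set.Ioo (0 : ℝ) (1 / (l : ℝ))) (ldH₁ α l t)

/-- `Λ_{α,l}(λ)`: zero for `λ ≤ 0` and `log (1 + α ε₀(λ) / (1 - l ε₀(λ)))` for `λ > 0`. -/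
noncomputable def ldLambda (α : ℝ) (l : ℕ) (t : ℝ) : ℝ :=
  if t ≤ 0 then 0 else Real.log (1 + α * ldEps α l t / (1 - l * ldEps α l t))

/-- `I_l^α(x) = sup_λ {λ x - Λ_{α,l}(λ)}`, the supremum being over all real `λ`. -/
noncomputable def rateI (α : ℝ) (l : ℕ) (x : ℝ) : EReal :=
  ⨆ t : ℝ, ((t * x - ldLambda α l t : ℝ) : EReal)

/-!
The proof rests on an exact generating function for the moments of `u ^ M`, where `M` is the number
of blocks of size `l` after `m` further draws. Write `c = α (1 - α)_{(l - 1)} / l!`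
(`blockCoeff`). A block that is still to appear contributes the series `g` (`newBlockSeries`), with
`g(t) = 1 - (1 - t) ^ α + (u - 1) c t ^ l`; a block of current size `r` contributes
`blockSeries r = ∑ (r - α)_{(k)} t ^ k / k!`, with an extra weight `u` at final size `l`. For a
sample of size `i` with `K` blocks, the formal power series
`futureSeries = (1 - g) ^ (-(θ / α + K)) * ∏ blockSeries (size)` has as its derivative the sum of
the same series over all possible next draws, with the unnormalized predictive probabilities as
weights (`derivative_futureSeries`). Hence its `m`-th coefficient, times `m! / (θ + i)_{(m)}`, is
the conditional expectation of `u ^ M`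
(`IsEwensPitmanSample.setLIntegral_pow`).

The exponential growth rate of these coefficients is governed by the root `t₀` of `g(t) = 1`, that
is, of `(1 - t) ^ α = (u - 1) c t ^ l`. For `g(t) < 1` the series is summable at `t`; for
`g(t) > 1` the renewal equation satisfied by `1 / (1 - g)` bounds the coefficients from below by a
multiple of `t ^ (-m)`, and the exponent `θ / α + K` costs only a factor of order `m`. With
`u = e ^ λ` and `t₀ = e ^ (-s)` the equation can be solved explicitly for `λ`, which gives the
function `invLambda`; unwinding the definition of `Λ` through `h₁` and `h₂` shows
`Λ (invLambda s) = s` (`ldLambda_invLambda`). So the scaled cumulant generating functions converge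
to `Λ` on `(0, ∞)` (`IsEwensPitmanSample.hasLogMGFLimit`).

The large deviation principle then follows as in the Gärtner-Ellis theorem
(`HasLogMGFLimit.satisfiesLDP`): the upper bound is the exponential Chebyshev inequality, and the
lower bound comes from tilting, since each `x ∈ (0, 1 / l)` is the slope of `Λ` at some point. All
of this is carried out in the parameter `s`, so that `Λ` itself is never differentiated. The
argument at `x = 0` uses that `Λ` has slope `0` there, and the endpoint `1 / l` is reached by
monotonicity of the rate function.

On the probabilistic side, the predictive rule, which concerns fixed measurable sets, is first
turned into the joint law of the past and the next draw
(`IsEwensPitmanSample.lintegral_prefix_next`). As `ν` has no atoms, this gives the transition rule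
for every function of the pattern of coincidences (`IsEwensPitmanSample.lintegral_step`); all the
quantities involved, including the conditioning event, are functions of this pattern.
-/

/-! ### The inverse of the limiting cumulant generating function -/

/-- The constant `α (1 - α)_{(l - 1)} / l!`. -/
noncomputable def blockCoeff (α : ℝ) (l : ℕ) : ℝ :=
  α * (ascPochhammer ℝ (l - 1)).eval (1 - α) / (l.factorial : ℝ)

/-- The inverse on `(0, ∞)` of `ldLambda α l`. -/
noncomputable def invLambda (α : ℝ) (l : ℕ) (s : ℝ) : ℝ :=
  Real.log (1 + (1 - Real.exp (-s)) ^ α * Real.exp (l * s) / blockCoeff α l)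

section Analysis

variable {α : ℝ} {l : ℕ}

theorem blockCoeff_pos (hα : α ∈ Set.Ioo (0 : ℝ) 1) : 0 < blockCoeff α l := by
  have := ascPochhammer_pos (S := ℝ) (l - 1) (1 - α) (by linarith [hα.2])
  have := hα.1
  unfold blockCoeff
  positivity

theorem one_sub_exp_neg_pos {s : ℝ} (hs : 0 < s) : 0 < 1 - Real.exp (-s) := by
  have : Real.exp (-s) < 1 := by rw [Real.exp_lt_one_iff]; linarith
  linarith

theorem exp_invLambda (hα : α ∈ Set.Ioo (0 : ℝ) 1) {s : ℝ} (hs : 0 ≤ s) :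
    Real.exp (invLambda α l s)
      = 1 + (1 - Real.exp (-s)) ^ α * Real.exp (l * s) / blockCoeff α l := by
  have h1 : 0 ≤ 1 - Real.exp (-s) := by
    have : Real.exp (-s) ≤ 1 := Real.exp_le_one_iff.2 (by linarith)
    linarith
  have := blockCoeff_pos (l := l) hα
  rw [invLambda, Real.exp_log]
  positivity

theorem invLambda_pos (hα : α ∈ Set.Ioo (0 : ℝ) 1) {s : ℝ} (hs : 0 < s) :
    0 < invLambda α l s := by
  have := blockCoeff_pos (l := l) hα
  have := one_sub_exp_neg_pos hs
  rw [← Real.exp_lt_exp, exp_invLambda hα hs.le, Real.exp_zero]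
  have : 0 < (1 - Real.exp (-s)) ^ α * Real.exp (l * s) / blockCoeff α l := by positivity
  linarith

theorem strictMonoOn_ldH₂ (hα : α ∈ Set.Ioo (0 : ℝ) 1) (hl : 1 ≤ l) :
    StrictMonoOn (ldH₂ α l) (Set.Ioo (0 : ℝ) (1 / (l : ℝ))) := by
  obtain ⟨h0, h1⟩ := hα
  have hl' : (1 : ℝ) ≤ l := by exact_mod_cast hl
  have key : ∀ z ∈ Set.Ioo (0 : ℝ) (1 / (l : ℝ)), 0 < 1 - l * z ∧ 0 < 1 - (l - α) * z := by
    rintro z ⟨hz0, hz1⟩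
    rw [lt_div_iff₀ (by linarith)] at hz1
    constructor <;> nlinarith
  intro x hx y hy hxy
  obtain ⟨hx1, hx2⟩ := key x hx
  obtain ⟨hy1, hy2⟩ := key y hy
  have hx0 := hx.1
  have hy0 := hy.1
  unfold ldH₂
  apply add_lt_add
  · refine mul_lt_mul_of_pos_left (Real.log_lt_log (by positivity) ?_) (by linarith)
    rw [div_lt_div_iff₀ hx1 hy1]
    nlinarith [mul_pos h0 (sub_pos.2 hxy)]
  · refine mul_lt_mul_of_pos_left (Real.log_lt_log (by positivity) ?_) h0
    rw [div_lt_div_iff₀ hx2 hy2]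
    nlinarith

/-- The equation `h₂ ε = h₁ (invLambda s)` has the explicit solution
`ε = (1 - t) / (l (1 - t) + α t)` with `t = e^{-s}`. -/
theorem ldLambda_invLambda (hα : α ∈ Set.Ioo (0 : ℝ) 1) (hl : 1 ≤ l) {s : ℝ} (hs : 0 < s) :
    ldLambda α l (invLambda α l s) = s := by
  have hpos := invLambda_pos (l := l) hα hs
  have hexp := exp_invLambda (l := l) hα hs.le
  have hc := blockCoeff_pos (l := l) hα
  have ht1 := one_sub_exp_neg_pos hs
  obtain ⟨h0, h1⟩ := hα
  have hl' : (1 : ℝ) ≤ l := by exact_mod_cast hl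
  set L := invLambda α l s with hL
  set t := Real.exp (-s) with ht
  have ht0 : 0 < t := Real.exp_pos _
  have hlogt : Real.log t = -s := by rw [ht, Real.log_exp]
  set D := l * (1 - t) + α * t with hD
  have hDpos : 0 < D := by positivity
  -- `ε` is the solution of `t = (1 - l ε) / (1 - (l - α) ε)`
  set e := (1 - t) / D with he
  have e1 : 1 - l * e = α * t / D := by rw [he]; field_simp; rw [hD]; ring
  have e2 : 1 - (l - α) * e = α / D := by rw [he]; field_simp; rw [hD]; ring
  have hemem : e ∈ Set.Ioo (0 : ℝ) (1 / (l : ℝ)) := by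
    refine ⟨by positivity, ?_⟩
    rw [he, div_lt_div_iff₀ hDpos (by linarith), hD]
    nlinarith [mul_pos h0 ht0]
  have hh2 : ldH₂ α l e = ldH₁ α l L := by
    have r1 : (1 - (l - α) * e) / (1 - l * e) = 1 / t := by rw [e1, e2]; field_simp
    have r2 : e / (1 - (l - α) * e) = (1 - t) / α := by rw [e2, he]; field_simp
    have r3 : α * (ascPochhammer ℝ (l - 1)).eval (1 - α) / (α ^ α * (l.factorial : ℝ))
        = blockCoeff α l / α ^ α := by unfold blockCoeff; field_simp
    have hE : Real.exp L - 1 = (1 - t) ^ α * Real.exp (l * s) / blockCoeff α l := by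
      rw [hexp]; ring
    have hp : 0 < Real.exp L - 1 := by rw [hE]; positivity
    unfold ldH₂ ldH₁
    rw [r1, r2, r3, Real.log_div hp.ne' (Real.exp_pos _).ne', Real.log_exp, hE,
      Real.log_div (by positivity) hc.ne', Real.log_mul (by positivity) (by positivity),
      Real.log_rpow ht1, Real.log_exp, Real.log_div hc.ne' (by positivity), Real.log_rpow h0,
      Real.log_div one_ne_zero ht0.ne', Real.log_one, hlogt, Real.log_div ht1.ne' h0.ne']
    ring
  have heps : ldEps α l L = e := by
    rw [ldEps, ← hh2]
    exact (strictMonoOn_ldH₂ ⟨h0, h1⟩ hl).injOn.leftInvOn_invFunOn hemem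
  rw [ldLambda, if_neg (not_le.2 hpos), heps, e1]
  have : 1 + α * e / (α * t / D) = t⁻¹ := by rw [he]; field_simp; ring
  rw [this, Real.log_inv, hlogt, neg_neg]

theorem invLambda_zero (hα : α ∈ Set.Ioo (0 : ℝ) 1) : invLambda α l 0 = 0 := by
  simp [invLambda, Real.zero_rpow hα.1.ne']

theorem continuousOn_invLambda (hα : α ∈ Set.Ioo (0 : ℝ) 1) :
    ContinuousOn (invLambda α l) (Set.Ici 0) := by
  intro s hs
  have h1 := exp_invLambda (l := l) hα hs
  apply ContinuousAt.continuousWithinAt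
  unfold invLambda
  refine ContinuousAt.log ?_ (by rw [← h1]; exact (Real.exp_pos _).ne')
  have : Continuous fun s : ℝ => (1 - Real.exp (-s)) ^ α :=
    Continuous.rpow_const (by fun_prop) (fun _ => Or.inr hα.1.le)
  fun_prop

/-- With `exists_le_invLambda_add`: `invLambda` grows linearly with slope `l`, up to a bounded
error. This is why the rate function is finite at `1 / l` and infinite beyond. -/
theorem invLambda_le (hα : α ∈ Set.Ioo (0 : ℝ) 1) {s : ℝ} (hs : 0 ≤ s) :
    invLambda α l s ≤ Real.log (1 + 1 / blockCoeff α l) + l * s := by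
  have hc := blockCoeff_pos (l := l) hα
  have h1 : 0 ≤ 1 - Real.exp (-s) := by
    have : Real.exp (-s) ≤ 1 := Real.exp_le_one_iff.2 (by linarith)
    linarith
  have h2 : (1 - Real.exp (-s)) ^ α ≤ 1 :=
    Real.rpow_le_one h1 (by linarith [Real.exp_pos (-s)]) hα.1.le
  have h3 : 1 ≤ Real.exp (l * s) := Real.one_le_exp (by positivity)
  rw [← Real.exp_le_exp, exp_invLambda hα hs, Real.exp_add, Real.exp_log (by positivity), add_mul,
    one_mul, one_div_mul_eq_div]
  gcongr
  nlinarith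

theorem exists_le_invLambda_add (hα : α ∈ Set.Ioo (0 : ℝ) 1) :
    ∃ C : ℝ, ∀ s : ℝ, 0 < s → l * s ≤ invLambda α l s + C := by
  have hc := blockCoeff_pos (l := l) hα
  refine ⟨|Real.log (blockCoeff α l * 2 ^ α)| + l * Real.log 2, fun s hs => ?_⟩
  have hl2 : 0 < Real.log 2 := Real.log_pos one_lt_two
  have hL := invLambda_pos (l := l) hα hs
  rcases le_or_gt (Real.log 2) s with h | h
  · have h1 : (2 : ℝ)⁻¹ ≤ 1 - Real.exp (-s) := by
      have : Real.exp (-s) ≤ 2⁻¹ := by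
        rw [← Real.exp_log (show (0 : ℝ) < 2⁻¹ by norm_num), Real.log_inv]
        exact Real.exp_le_exp.2 (by linarith)
      norm_num at this ⊢; linarith
    have h2 : ((2 : ℝ) ^ α)⁻¹ ≤ (1 - Real.exp (-s)) ^ α := by
      rw [← Real.inv_rpow (by norm_num)]
      exact Real.rpow_le_rpow (by norm_num) h1 hα.1.le
    have h3 : l * s ≤ invLambda α l s + Real.log (blockCoeff α l * 2 ^ α) := by
      rw [← Real.exp_le_exp, Real.exp_add, exp_invLambda hα hs.le, Real.exp_log (by positivity)]
      have h4 : ((2 : ℝ) ^ α)⁻¹ * Real.exp (l * s) / blockCoeff α l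
          ≤ 1 + (1 - Real.exp (-s)) ^ α * Real.exp (l * s) / blockCoeff α l := by
        have : ((2 : ℝ) ^ α)⁻¹ * Real.exp (l * s) / blockCoeff α l
          ≤ (1 - Real.exp (-s)) ^ α * Real.exp (l * s) / blockCoeff α l := by gcongr
        linarith
      calc Real.exp (l * s) = ((2 : ℝ) ^ α)⁻¹ * Real.exp (l * s) / blockCoeff α l
            * (blockCoeff α l * 2 ^ α) := by field_simp
        _ ≤ _ := by gcongr
    have : 0 ≤ (l : ℝ) * Real.log 2 := by positivity
    linarith [le_abs_self (Real.log (blockCoeff α l * 2 ^ α))]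
  · have : l * s ≤ l * Real.log 2 := by gcongr
    linarith [abs_nonneg (Real.log (blockCoeff α l * 2 ^ α))]

theorem exists_invLambda_eq (hα : α ∈ Set.Ioo (0 : ℝ) 1) (hl : 1 ≤ l) {t : ℝ} (ht : 0 < t) :
    ∃ s, 0 < s ∧ invLambda α l s = t := by
  obtain ⟨C, hC⟩ := exists_le_invLambda_add (l := l) hα
  have hl' : (1 : ℝ) ≤ l := by exact_mod_cast hl
  set S := t + |C| with hS
  have hS0 : 0 < S := by positivity
  have h1 : t ≤ invLambda α l S := by
    have := hC S hS0
    nlinarith [le_abs_self C]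
  obtain ⟨s, hs, hst⟩ := intermediate_value_Icc hS0.le
    ((continuousOn_invLambda (l := l) hα).mono Set.Icc_subset_Ici_self)
    (show t ∈ Set.Icc (invLambda α l 0) (invLambda α l S) by
      rw [invLambda_zero hα]; exact ⟨ht.le, h1⟩)
  refine ⟨s, lt_of_le_of_ne hs.1 ?_, hst⟩
  rintro rfl
  rw [invLambda_zero hα] at hst
  exact ht.ne hst

/-- Since `1 - e^{-s}` is raised to a power less than `1`, `invLambda` has infinite slope at `0`. -/
theorem exists_lt_invLambda_mul (hα : α ∈ Set.Ioo (0 : ℝ) 1) {x : ℝ} (hx : 0 < x) :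
    ∃ s, 0 < s ∧ s < invLambda α l s * x := by
  have hc := blockCoeff_pos (l := l) hα
  have hlim : Tendsto (fun s : ℝ => (2 / x * 2 ^ α * blockCoeff α l) * s ^ (1 - α)) (𝓝[>] 0)
      (𝓝 0) := by
    have h : ContinuousAt (fun s : ℝ => (2 / x * 2 ^ α * blockCoeff α l) * s ^ (1 - α)) 0 :=
      continuousAt_const.mul (Real.continuousAt_rpow_const _ _ (Or.inr (by linarith [hα.2])))
    have h' := h.tendsto
    simp only [Real.zero_rpow (show 1 - α ≠ 0 by linarith [hα.2]), mul_zero] at h'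
    exact h'.mono_left nhdsWithin_le_nhds
  have hev := (hlim.eventually_lt_const one_pos).and
    ((Ioo_mem_nhdsGT (show (0 : ℝ) < min x 1 by positivity)))
  obtain ⟨s, hs, hs0, hs1⟩ := hev.exists
  refine ⟨s, hs0, ?_⟩
  have hsx : s < x := hs1.trans_le (min_le_left _ _)
  have hs1' : s < 1 := hs1.trans_le (min_le_right _ _)
  rw [← div_lt_iff₀ hx, ← Real.exp_lt_exp, exp_invLambda hα hs0.le]
  -- `e^{s/x} ≤ 1 + 2 s / x` and `1 - e^{-s} ≥ s / 2` for small `s`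
  have b1 : Real.exp (s / x) ≤ 1 + 2 * (s / x) := by
    have h1 : |s / x| ≤ 1 := by
      rw [abs_of_pos (by positivity), div_le_one hx]; exact hsx.le
    have h2 := Real.abs_exp_sub_one_le h1
    rw [abs_of_pos (show 0 < s / x by positivity)] at h2
    linarith [le_abs_self (Real.exp (s / x) - 1)]
  have b2 : s / 2 ≤ 1 - Real.exp (-s) := by
    have h3 : Real.exp (-s) ≤ (1 + s)⁻¹ := by
      rw [Real.exp_neg]
      exact inv_anti₀ (by linarith) (by linarith [Real.add_one_le_exp s])
    have h4 : (1 + s)⁻¹ ≤ 1 - s / 2 := by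
      rw [inv_le_iff_one_le_mul₀ (by linarith)]
      nlinarith
    linarith
  have b3 : (s / 2) ^ α ≤ (1 - Real.exp (-s)) ^ α := Real.rpow_le_rpow (by positivity) b2 hα.1.le
  have b4 : 1 ≤ Real.exp (l * s) := Real.one_le_exp (by positivity)
  have b5 : 2 * (s / x) < (s / 2) ^ α / blockCoeff α l := by
    rw [lt_div_iff₀ hc, Real.div_rpow hs0.le (by norm_num), lt_div_iff₀ (by positivity)]
    have h6 : s = s ^ α * s ^ (1 - α) := by
      rw [← Real.rpow_add hs0]; simp
    have h7 : 0 < s ^ α := by positivity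
    calc 2 * (s / x) * blockCoeff α l * 2 ^ α = (2 / x * 2 ^ α * blockCoeff α l) * s := by ring
      _ = s ^ α * ((2 / x * 2 ^ α * blockCoeff α l) * s ^ (1 - α)) := by
        conv_lhs => rw [h6]
        ring
      _ < s ^ α * 1 := by gcongr
      _ = _ := mul_one _
  have b6 : (s / 2) ^ α / blockCoeff α l
      ≤ (1 - Real.exp (-s)) ^ α * Real.exp (l * s) / blockCoeff α l := by
    gcongr
    nlinarith [show 0 ≤ (s / 2) ^ α by positivity]
  linarith

theorem differentiableAt_invLambda (hα : α ∈ Set.Ioo (0 : ℝ) 1) {s : ℝ} (hs : 0 < s) :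
    DifferentiableAt ℝ (invLambda α l) s := by
  have h1 := exp_invLambda (l := l) hα hs.le
  have h2 := one_sub_exp_neg_pos hs
  unfold invLambda
  refine DifferentiableAt.log ?_ (by rw [← h1]; exact (Real.exp_pos _).ne')
  have : DifferentiableAt ℝ (fun s : ℝ => (1 - Real.exp (-s)) ^ α) s :=
    DifferentiableAt.rpow_const (by fun_prop) (Or.inl h2.ne')
  fun_prop

/-- Every `x ∈ (0, 1/l)` is the slope of `Λ` at some point. -/
theorem exists_hasDerivAt_invLambda (hα : α ∈ Set.Ioo (0 : ℝ) 1) (hl : 1 ≤ l) {x : ℝ}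
    (hx : x ∈ Set.Ioo (0 : ℝ) (1 / (l : ℝ))) :
    ∃ s, 0 < s ∧ HasDerivAt (invLambda α l) (1 / x) s := by
  obtain ⟨hx0, hx1⟩ := hx
  have hl' : (1 : ℝ) ≤ l := by exact_mod_cast hl
  have hlx : 0 < 1 - l * x := by
    rw [lt_div_iff₀ (by linarith)] at hx1; linarith
  obtain ⟨s₁, hs₁, hs₁'⟩ := exists_lt_invLambda_mul (l := l) hα hx0
  set C := Real.log (1 + 1 / blockCoeff α l) with hC
  -- beyond `S` the function `invLambda s * x - s` is negative
  set S := s₁ + |C| * x / (1 - l * x) with hS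
  have hS0 : 0 < S := by positivity
  have hneg : invLambda α l S * x - S ≤ 0 := by
    have h1 := invLambda_le (l := l) hα hS0.le
    have h2 : invLambda α l S * x ≤ (C + l * S) * x := by gcongr
    have h3 : |C| * x ≤ S * (1 - l * x) := by
      rw [hS, add_mul, div_mul_cancel₀ _ hlx.ne']
      have := mul_pos hs₁ hlx
      linarith
    nlinarith [le_abs_self C]
  set f := fun s => invLambda α l s * x - s with hf
  have hcont : ContinuousOn f (Set.Icc 0 S) :=
    (((continuousOn_invLambda (l := l) hα).mono Set.Icc_subset_Ici_self).mul
      continuousOn_const).sub continuousOn_id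
  obtain ⟨s, hs, hmax⟩ := isCompact_Icc.exists_isMaxOn (Set.nonempty_Icc.2 hS0.le) hcont
  have hs1mem : s₁ ∈ Set.Icc 0 S := ⟨hs₁.le, by
    have : 0 ≤ |C| * x / (1 - l * x) := by positivity
    linarith⟩
  have hfs : 0 < f s := lt_of_lt_of_le (by simp only [hf]; linarith) (hmax hs1mem)
  have hs0 : 0 < s := by
    refine lt_of_le_of_ne hs.1 ?_
    rintro rfl
    simp [hf, invLambda_zero hα] at hfs
  have hsS : s < S := by
    refine lt_of_le_of_ne hs.2 ?_
    rintro rfl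
    exact absurd hfs (not_lt.2 hneg)
  refine ⟨s, hs0, ?_⟩
  have hd := (differentiableAt_invLambda (l := l) hα hs0).hasDerivAt
  have hloc : IsLocalMax f s := hmax.isLocalMax (Icc_mem_nhds hs0 hsS)
  have h0 := hloc.hasDerivAt_eq_zero ((hd.mul_const x).sub (hasDerivAt_id s))
  have : deriv (invLambda α l) s = 1 / x := by
    rw [eq_div_iff hx0.ne']; linarith
  rwa [this] at hd

end Analysis

/-! ### The rate function -/

section Rate

variable {α : ℝ} {l : ℕ}

theorem le_rateI (x t : ℝ) : ((t * x - ldLambda α l t : ℝ) : EReal) ≤ rateI α l x :=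
  le_iSup (fun t : ℝ => ((t * x - ldLambda α l t : ℝ) : EReal)) t

theorem invLambda_mul_sub_le_rateI (hα : α ∈ Set.Ioo (0 : ℝ) 1) (hl : 1 ≤ l) (x : ℝ) {s : ℝ}
    (hs : 0 < s) : ((invLambda α l s * x - s : ℝ) : EReal) ≤ rateI α l x := by
  have := le_rateI (α := α) (l := l) x (invLambda α l s)
  rwa [ldLambda_invLambda hα hl hs] at this

theorem rateI_nonneg (x : ℝ) : 0 ≤ rateI α l x := by
  simpa [ldLambda] using le_rateI (α := α) (l := l) x 0

/-- For `x ≥ 0` only positive tilts matter, and these are the values of `invLambda`. -/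
theorem rateI_le (hα : α ∈ Set.Ioo (0 : ℝ) 1) (hl : 1 ≤ l) {x : ℝ} (hx : 0 ≤ x) {K : EReal}
    (hK : 0 ≤ K) (h : ∀ s : ℝ, 0 < s → ((invLambda α l s * x - s : ℝ) : EReal) ≤ K) :
    rateI α l x ≤ K := by
  refine iSup_le fun t => ?_
  rcases le_or_gt t 0 with ht | ht
  · refine le_trans ?_ hK
    rw [ldLambda, if_pos ht]
    exact_mod_cast (by nlinarith : t * x - 0 ≤ 0)
  · obtain ⟨s, hs, rfl⟩ := exists_invLambda_eq hα hl ht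
    rw [ldLambda_invLambda hα hl hs]
    exact h s hs

theorem rateI_zero (hα : α ∈ Set.Ioo (0 : ℝ) 1) (hl : 1 ≤ l) : rateI α l 0 = 0 := by
  refine le_antisymm (rateI_le hα hl le_rfl le_rfl fun s hs => ?_) (rateI_nonneg 0)
  exact_mod_cast (by linarith : invLambda α l s * 0 - s ≤ 0)

theorem lowerSemicontinuous_rateI : LowerSemicontinuous (rateI α l) := by
  have : rateI α l = fun x => ⨆ t : ℝ, ((t * x - ldLambda α l t : ℝ) : EReal) := rfl
  rw [this]
  refine lowerSemicontinuous_iSup fun t => Continuous.lowerSemicontinuous ?_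
  exact continuous_coe_real_ereal.comp (by fun_prop)

theorem rateI_mono (hα : α ∈ Set.Ioo (0 : ℝ) 1) (hl : 1 ≤ l) {x y : ℝ} (hx : 0 ≤ x)
    (hxy : x ≤ y) : rateI α l x ≤ rateI α l y := by
  refine rateI_le hα hl hx (rateI_nonneg y) fun s hs => ?_
  refine le_trans ?_ (invLambda_mul_sub_le_rateI hα hl y hs)
  have := invLambda_pos (l := l) hα hs
  exact_mod_cast (by nlinarith : invLambda α l s * x - s ≤ invLambda α l s * y - s)

theorem rateI_one_div_lt_top (hα : α ∈ Set.Ioo (0 : ℝ) 1) (hl : 1 ≤ l) :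
    rateI α l (1 / l) < ⊤ := by
  have hl' : (1 : ℝ) ≤ l := by exact_mod_cast hl
  have hc := blockCoeff_pos (l := l) hα
  set C := Real.log (1 + 1 / blockCoeff α l)
  have hC : 0 ≤ C := Real.log_nonneg (by
    have : 0 ≤ 1 / blockCoeff α l := by positivity
    linarith)
  refine (rateI_le hα hl (by positivity) (K := ((C / l : ℝ) : EReal))
    (by exact_mod_cast (by positivity : 0 ≤ C / l)) fun s hs => ?_).trans_lt (EReal.coe_lt_top _)
  have h1 := invLambda_le (l := l) hα hs.le
  have h2 : invLambda α l s * (1 / l) - s ≤ C / l := by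
    calc invLambda α l s * (1 / l) - s ≤ (C + l * s) * (1 / l) - s := by gcongr
      _ = C / l := by field_simp; ring
  exact_mod_cast h2

theorem rateI_lt_top (hα : α ∈ Set.Ioo (0 : ℝ) 1) (hl : 1 ≤ l) {x : ℝ} (h0 : 0 ≤ x)
    (h1 : x ≤ 1 / l) : rateI α l x < ⊤ :=
  (rateI_mono hα hl h0 h1).trans_lt (rateI_one_div_lt_top hα hl)

theorem rateI_eq_top (hα : α ∈ Set.Ioo (0 : ℝ) 1) (hl : 1 ≤ l) {x : ℝ}
    (hx : x ∉ Set.Icc (0 : ℝ) (1 / (l : ℝ))) : rateI α l x = ⊤ := by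
  have hl' : (1 : ℝ) ≤ l := by exact_mod_cast hl
  rw [EReal.eq_top_iff_forall_lt]
  intro K
  rcases lt_or_ge x 0 with h | h
  · have h1 := le_rateI (α := α) (l := l) x ((|K| + 1) / x)
    have h2 : (|K| + 1) / x ≤ 0 := div_nonpos_of_nonneg_of_nonpos (by positivity) h.le
    rw [ldLambda, if_pos h2, div_mul_cancel₀ _ h.ne] at h1
    refine lt_of_lt_of_le ?_ h1
    exact_mod_cast (by linarith [le_abs_self K] : K < |K| + 1 - 0)
  · have hx1 : 1 / (l : ℝ) < x := by
      by_contra h'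
      exact hx ⟨h, not_lt.1 h'⟩
    have hx2 : 0 < l * x - 1 := by
      rw [div_lt_iff₀ (by linarith)] at hx1; linarith
    obtain ⟨C, hC⟩ := exists_le_invLambda_add (l := l) hα
    set s := (|K| + 1 + |C| * x) / (l * x - 1) with hs
    have hs0 : 0 < s := by positivity
    refine lt_of_lt_of_le ?_ (invLambda_mul_sub_le_rateI hα hl x hs0)
    have h3 := hC s hs0
    have h4 : s * (l * x - 1) = |K| + 1 + |C| * x := by rw [hs, div_mul_cancel₀ _ hx2.ne']
    have h5 : (l * s - |C|) * x ≤ invLambda α l s * x := by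
      gcongr
      linarith [le_abs_self C]
    have h6 : K < invLambda α l s * x - s := by
      nlinarith [le_abs_self K]
    exact_mod_cast h6

theorem isCompact_rateI_le (hα : α ∈ Set.Ioo (0 : ℝ) 1) (hl : 1 ≤ l) (c : ℝ) :
    IsCompact {x : ℝ | rateI α l x ≤ (c : EReal)} := by
  refine isCompact_Icc.of_isClosed_subset
    (lowerSemicontinuous_rateI.isClosed_preimage (c : EReal))
    (fun x hx => ?_ : _ ⊆ Set.Icc (0 : ℝ) (1 / (l : ℝ)))
  by_contra h
  rw [Set.mem_ofPred_eq, rateI_eq_top hα hl h] at hx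
  exact absurd hx (not_le.2 (EReal.coe_lt_top c))

/-- Convexity makes the rate function right-continuous on `[0, 1/l)`. -/
theorem iInf_rateI_Ioi_le (hα : α ∈ Set.Ioo (0 : ℝ) 1) (hl : 1 ≤ l) {x : ℝ} (h0 : 0 ≤ x)
    (h1 : x < 1 / l) : ⨅ y ∈ Set.Ioi x, rateI α l y ≤ rateI α l x := by
  have hxt := rateI_lt_top hα hl h0 h1.le
  have hlt := rateI_one_div_lt_top hα hl
  obtain ⟨a, ha⟩ : ∃ a : ℝ, (a : EReal) = rateI α l x :=
    ⟨_, EReal.coe_toReal hxt.ne (ne_bot_of_le_ne_bot EReal.zero_ne_bot (rateI_nonneg x))⟩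
  obtain ⟨b, hb⟩ : ∃ b : ℝ, (b : EReal) = rateI α l (1 / l) :=
    ⟨_, EReal.coe_toReal hlt.ne (ne_bot_of_le_ne_bot EReal.zero_ne_bot (rateI_nonneg _))⟩
  have ha0 : 0 ≤ a := by
    have := rateI_nonneg (α := α) (l := l) x; rw [← ha] at this; exact_mod_cast this
  have hb0 : 0 ≤ b := by
    have := rateI_nonneg (α := α) (l := l) (1 / l); rw [← hb] at this; exact_mod_cast this
  rw [← ha]
  refine EReal.le_of_forall_lt_iff_le.1 fun z hz => ?_
  have hz' : a < z := by exact_mod_cast hz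
  -- the point `(1 - κ) x + κ / l` lies to the right of `x`
  set κ := min 1 ((z - a) / (b + 1)) with hκ
  have hκ0 : 0 < κ := lt_min one_pos (div_pos (by linarith) (by linarith))
  have hκ1 : κ ≤ 1 := min_le_left _ _
  have hκ2 : κ * (b + 1) ≤ z - a := by
    rw [← le_div_iff₀ (by linarith)]; exact min_le_right _ _
  set y := (1 - κ) * x + κ * (1 / l) with hy
  have hxy : x < y := by nlinarith
  refine (iInf₂_le y hxy).trans
    (rateI_le hα hl (by linarith) (by exact_mod_cast (by linarith : (0 : ℝ) ≤ z)) fun s hs => ?_)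
  have e1 := invLambda_mul_sub_le_rateI hα hl x hs
  have e2 := invLambda_mul_sub_le_rateI hα hl (1 / l) hs
  rw [← ha] at e1
  rw [← hb] at e2
  have e1' : invLambda α l s * x - s ≤ a := by exact_mod_cast e1
  have e2' : invLambda α l s * (1 / l) - s ≤ b := by exact_mod_cast e2
  have : invLambda α l s * y - s ≤ z := by
    calc invLambda α l s * y - s
        = (1 - κ) * (invLambda α l s * x - s) + κ * (invLambda α l s * (1 / l) - s) := by
          rw [hy]; ring
      _ ≤ (1 - κ) * a + κ * b :=
          add_le_add (mul_le_mul_of_nonneg_left e1' (by linarith))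
            (mul_le_mul_of_nonneg_left e2' hκ0.le)
      _ ≤ z := by nlinarith
  exact_mod_cast this

end Rate

/-! ### Exponential bounds and logarithmic limits -/

section EReal

theorem inv_mul_log_ofReal_exp {m : ℕ} (hm : 1 ≤ m) (c : ℝ) :
    (((m : ℝ)⁻¹ : ℝ) : EReal) * ENNReal.log (ENNReal.ofReal (Real.exp (m * c))) = c := by
  have hm' : (m : ℝ) ≠ 0 := by positivity
  rw [ENNReal.log_ofReal_of_pos (Real.exp_pos _), Real.log_exp, ← EReal.coe_mul]
  congr 1
  field_simp

theorem limsup_inv_mul_log_le {q : ℕ → ENNReal} {c : ℝ}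
    (h : ∀ᶠ m : ℕ in atTop, q m ≤ ENNReal.ofReal (Real.exp (m * c))) :
    limsup (fun m : ℕ => (((m : ℝ)⁻¹ : ℝ) : EReal) * ENNReal.log (q m)) atTop ≤ c := by
  refine limsup_le_of_le (by isBoundedDefault) ?_
  filter_upwards [h, eventually_ge_atTop 1] with m hm hm1
  rw [← inv_mul_log_ofReal_exp hm1 c]
  exact mul_le_mul_of_nonneg_left (ENNReal.log_monotone hm)
    (by exact_mod_cast (by positivity : (0 : ℝ) ≤ (m : ℝ)⁻¹))

theorem le_liminf_inv_mul_log {q : ℕ → ENNReal} {c : ℝ}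
    (h : ∀ᶠ m : ℕ in atTop, ENNReal.ofReal (Real.exp (m * c)) ≤ q m) :
    (c : EReal) ≤ liminf (fun m : ℕ => (((m : ℝ)⁻¹ : ℝ) : EReal) * ENNReal.log (q m)) atTop := by
  refine le_liminf_of_le (by isBoundedDefault) ?_
  filter_upwards [h, eventually_ge_atTop 1] with m hm hm1
  rw [← inv_mul_log_ofReal_exp hm1 c]
  exact mul_le_mul_of_nonneg_left (ENNReal.log_monotone hm)
    (by exact_mod_cast (by positivity : (0 : ℝ) ≤ (m : ℝ)⁻¹))

theorem eventually_const_le_exp_mul (K : ℝ) {c : ℝ} (hc : 0 < c) :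
    ∀ᶠ m : ℕ in atTop, K ≤ Real.exp (m * c) :=
  (Real.tendsto_exp_atTop.comp
    (tendsto_natCast_atTop_atTop.atTop_mul_const hc)).eventually_ge_atTop K

end EReal

/-! ### The large deviation principle from the cumulant generating function -/

section LDP

variable {Ω : Type*} [MeasurableSpace Ω]

/-- The logarithmic moment generating functions of `m Z_m` divided by `m` converge on `(0, ∞)` to
the inverse of `invLambda α l`, that is, to `Λ`. -/
structure HasLogMGFLimit (α : ℝ) (l : ℕ) (Q : Measure Ω) (Z : ℕ → Ω → ℝ) : Prop where
  upper : ∀ s : ℝ, 0 < s → ∀ s', s < s' → ∀ᶠ m : ℕ in atTop,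
    ∫⁻ ω, ENNReal.ofReal (Real.exp (m * (invLambda α l s * Z m ω))) ∂Q
      ≤ ENNReal.ofReal (Real.exp (m * s'))
  lower : ∀ s : ℝ, 0 < s → ∀ s', s' < s → ∀ᶠ m : ℕ in atTop,
    ENNReal.ofReal (Real.exp (m * s'))
      ≤ ∫⁻ ω, ENNReal.ofReal (Real.exp (m * (invLambda α l s * Z m ω))) ∂Q

variable {α : ℝ} {l : ℕ} {Q : Measure Ω} {Z : ℕ → Ω → ℝ}

/-- Change of the tilting parameter from `u` to `v` on the side of `y` where this increases the
integrand, up to a factor that depends on `y` only. -/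
theorem setLIntegral_exp_le (hZ : ∀ m, Measurable (Z m)) (m : ℕ) {u v y : ℝ} {A : Set Ω}
    (hA : MeasurableSet A) (h : ∀ ω ∈ A, 0 ≤ (v - u) * (Z m ω - y)) :
    ∫⁻ ω in A, ENNReal.ofReal (Real.exp (m * (u * Z m ω))) ∂Q
      ≤ ENNReal.ofReal (Real.exp (m * ((u - v) * y)))
        * ∫⁻ ω, ENNReal.ofReal (Real.exp (m * (v * Z m ω))) ∂Q := by
  have hm := hZ m
  rw [← lintegral_const_mul _ (by fun_prop)]
  refine (setLIntegral_mono' hA fun ω hω => ?_).trans (setLIntegral_le_lintegral _ _)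
  rw [← ENNReal.ofReal_mul (Real.exp_pos _).le, ← Real.exp_add]
  refine ENNReal.ofReal_le_ofReal (Real.exp_le_exp.2 ?_)
  have := h ω hω
  have : (m : ℝ) * (u * Z m ω) ≤ m * ((u - v) * y + v * Z m ω) :=
    mul_le_mul_of_nonneg_left (by nlinarith) (by positivity)
  linarith

/-- A part of the tilted integral is exponentially smaller than the whole if moving the tilt from
`u` to another value of `invLambda` lowers the exponent. -/
theorem HasLogMGFLimit.setLIntegral_le (H : HasLogMGFLimit α l Q Z) (hZ : ∀ m, Measurable (Z m))
    {u s y c : ℝ} (hs : 0 < s) (hc : (u - invLambda α l s) * y + s < c) (A : ℕ → Set Ω)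
    (hA : ∀ m, MeasurableSet (A m))
    (h : ∀ m, ∀ ω ∈ A m, 0 ≤ (invLambda α l s - u) * (Z m ω - y)) :
    ∀ᶠ m : ℕ in atTop, ∫⁻ ω in A m, ENNReal.ofReal (Real.exp (m * (u * Z m ω))) ∂Q
      ≤ ENNReal.ofReal (Real.exp (m * c)) := by
  filter_upwards [H.upper s hs (c - (u - invLambda α l s) * y) (by linarith)] with m hm
  refine (setLIntegral_exp_le hZ m (hA m) (h m)).trans ?_
  refine (mul_le_mul_right hm _).trans ?_
  rw [← ENNReal.ofReal_mul (Real.exp_pos _).le, ← Real.exp_add]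
  refine ENNReal.ofReal_le_ofReal (Real.exp_le_exp.2 (le_of_eq ?_))
  ring

/-- The exponential Chebyshev inequality. -/
theorem HasLogMGFLimit.measure_ge_le (H : HasLogMGFLimit α l Q Z) (hZ : ∀ m, Measurable (Z m))
    (hα : α ∈ Set.Ioo (0 : ℝ) 1) {s x c : ℝ} (hs : 0 < s) (hc : s - invLambda α l s * x < c) :
    ∀ᶠ m : ℕ in atTop, Q {ω | x ≤ Z m ω} ≤ ENNReal.ofReal (Real.exp (m * c)) := by
  have hpos := invLambda_pos (l := l) hα hs
  have := H.setLIntegral_le hZ (u := 0) (y := x) (c := c) hs (by linarith)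
    (fun m => {ω | x ≤ Z m ω}) (fun m => measurableSet_le measurable_const (hZ m))
    (fun m ω hω => by
      have : x ≤ Z m ω := hω
      have : 0 ≤ Z m ω - x := by linarith
      rw [sub_zero]; positivity)
  simpa using this

theorem exists_gt_of_hasDerivAt {f : ℝ → ℝ} {s x y : ℝ} (hx : 0 < x)
    (hf : HasDerivAt f (1 / x) s) (hy : x < y) :
    ∃ s', s < s' ∧ f s ≤ f s' ∧ s' - s < (f s' - f s) * y := by
  have h := (hasDerivAt_iff_tendsto_slope.1 hf).mono_left
    (nhdsWithin_mono s (fun z (hz : s < z) => hz.ne') : 𝓝[>] s ≤ 𝓝[≠] s)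
  have h1 : 1 / y < 1 / x := one_div_lt_one_div_of_lt hx hy
  obtain ⟨s', hs', hss'⟩ := ((h.eventually_const_lt h1).and self_mem_nhdsWithin).exists
  have hss : 0 < s' - s := sub_pos.2 hss'
  rw [slope_def_field, div_lt_div_iff₀ (by linarith) hss] at hs'
  refine ⟨s', hss', ?_, by linarith⟩
  have hy0 : 0 < y := hx.trans hy
  by_contra h'
  nlinarith

theorem exists_lt_of_hasDerivAt {f : ℝ → ℝ} {s x y : ℝ} (hs : 0 < s) (hx : 0 < x)
    (hf : HasDerivAt f (1 / x) s) (hy0 : 0 < y) (hy : y < x) :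
    ∃ s', 0 < s' ∧ s' < s ∧ f s' ≤ f s ∧ (f s - f s') * y < s - s' := by
  have h := (hasDerivAt_iff_tendsto_slope.1 hf).mono_left
    (nhdsWithin_mono s (fun z (hz : z < s) => hz.ne) : 𝓝[<] s ≤ 𝓝[≠] s)
  have h1 : 1 / x < 1 / y := one_div_lt_one_div_of_lt hy0 hy
  obtain ⟨s', ⟨hs', hs0⟩, hss'⟩ := (((h.eventually_lt_const h1).and
    (h.eventually_const_lt (show 0 < 1 / x by positivity))).and
      (Ioo_mem_nhdsLT hs)).exists
  have hss : 0 < s - s' := sub_pos.2 hss'.2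
  have hslope : slope f s s' = (f s - f s') / (s - s') := by
    rw [slope_def_field, ← neg_div_neg_eq, neg_sub, neg_sub]
  rw [hslope] at hs' hs0
  refine ⟨s', hss'.1, hss'.2, ?_, ?_⟩
  · rw [div_pos_iff_of_pos_right hss] at hs0; linarith
  · rwa [div_lt_div_iff₀ hss hy0, one_mul] at hs'

/-- The lower bound near a point where the slope of `Λ` is `x`: under the tilted measure, `Z m`
concentrates at `x`. -/
theorem HasLogMGFLimit.le_measure_Ioo (H : HasLogMGFLimit α l Q Z) (hZ : ∀ m, Measurable (Z m))
    (hα : α ∈ Set.Ioo (0 : ℝ) 1) {s x : ℝ} (hs : 0 < s) (hx : 0 < x)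
    (hd : HasDerivAt (invLambda α l) (1 / x) s) {δ : ℝ} (hδ : 0 < δ) (hδx : δ < x) {c : ℝ}
    (hc : c < s - invLambda α l s * (x + δ)) :
    ∀ᶠ m : ℕ in atTop, ENNReal.ofReal (Real.exp (m * c))
      ≤ Q {ω | Z m ω ∈ Set.Ioo (x - δ) (x + δ)} := by
  set u := invLambda α l s with hu
  have hu0 : 0 < u := invLambda_pos hα hs
  obtain ⟨s₁, hs₁, hu₁, hlt₁⟩ := exists_gt_of_hasDerivAt hx hd (show x < x + δ by linarith)
  obtain ⟨s₂, hs₂0, hs₂, hu₂, hlt₂⟩ :=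
    exists_lt_of_hasDerivAt hs hx hd (show 0 < x - δ by linarith) (by linarith)
  rw [← hu] at hu₁ hlt₁ hu₂ hlt₂
  -- a common gap `2 κ`
  obtain ⟨κ, hκ0, hκ1, hκ2, hκ3⟩ : ∃ κ > 0, (u - invLambda α l s₁) * (x + δ) + s₁ < s - 2 * κ ∧
      (u - invLambda α l s₂) * (x - δ) + s₂ < s - 2 * κ ∧ c ≤ s - 2 * κ - u * (x + δ) := by
    refine ⟨min (min ((s - ((u - invLambda α l s₁) * (x + δ) + s₁)) / 4)
      ((s - ((u - invLambda α l s₂) * (x - δ) + s₂)) / 4)) ((s - u * (x + δ) - c) / 4), ?_, ?_, ?_,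
      ?_⟩
    · refine lt_min (lt_min ?_ ?_) ?_ <;> linarith
    all_goals
      have a1 := min_le_left (min ((s - ((u - invLambda α l s₁) * (x + δ) + s₁)) / 4)
        ((s - ((u - invLambda α l s₂) * (x - δ) + s₂)) / 4)) ((s - u * (x + δ) - c) / 4)
      have a2 := min_le_right (min ((s - ((u - invLambda α l s₁) * (x + δ) + s₁)) / 4)
        ((s - ((u - invLambda α l s₂) * (x - δ) + s₂)) / 4)) ((s - u * (x + δ) - c) / 4)
      have a3 := min_le_left ((s - ((u - invLambda α l s₁) * (x + δ) + s₁)) / 4)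
        ((s - ((u - invLambda α l s₂) * (x - δ) + s₂)) / 4)
      have a4 := min_le_right ((s - ((u - invLambda α l s₁) * (x + δ) + s₁)) / 4)
        ((s - ((u - invLambda α l s₂) * (x - δ) + s₂)) / 4)
      linarith
  have E1 := H.setLIntegral_le hZ (u := u) (y := x + δ) (c := s - 2 * κ) (hs.trans hs₁) hκ1
    (fun m => {ω | x + δ ≤ Z m ω}) (fun m => measurableSet_le measurable_const (hZ m))
    (fun m ω hω => mul_nonneg (by linarith) (by linarith [show x + δ ≤ Z m ω from hω]))
  have E2 := H.setLIntegral_le hZ (u := u) (y := x - δ) (c := s - 2 * κ) hs₂0 hκ2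
    (fun m => {ω | Z m ω ≤ x - δ}) (fun m => measurableSet_le (hZ m) measurable_const)
    (fun m ω hω => mul_nonneg_of_nonpos_of_nonpos (by linarith)
      (by linarith [show Z m ω ≤ x - δ from hω]))
  filter_upwards [E1, E2, H.lower s hs (s - κ) (by linarith), eventually_const_le_exp_mul 3 hκ0]
    with m h1 h2 h3 h4
  set N := {ω | Z m ω ∈ Set.Ioo (x - δ) (x + δ)} with hN
  set g := fun ω => ENNReal.ofReal (Real.exp (m * (u * Z m ω))) with hg
  set b := Real.exp (m * (s - 2 * κ)) with hb
  have hNmeas : MeasurableSet N := hZ m measurableSet_Ioo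
  have hsplit : ∫⁻ ω, g ω ∂Q ≤ ∫⁻ ω in N, g ω ∂Q
      + (∫⁻ ω in {ω | x + δ ≤ Z m ω}, g ω ∂Q + ∫⁻ ω in {ω | Z m ω ≤ x - δ}, g ω ∂Q) := by
    rw [← setLIntegral_univ]
    refine (lintegral_mono_set (t := N ∪ ({ω | x + δ ≤ Z m ω} ∪ {ω | Z m ω ≤ x - δ})) ?_).trans ?_
    · intro ω _
      by_cases c1 : x + δ ≤ Z m ω
      · exact Or.inr (Or.inl c1)
      by_cases c2 : Z m ω ≤ x - δ
      · exact Or.inr (Or.inr c2)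
      · exact Or.inl ⟨not_le.1 c2, not_le.1 c1⟩
    · exact (lintegral_union_le _ _ _).trans (add_le_add_right (lintegral_union_le _ _ _) _)
  have hNg : ∫⁻ ω in N, g ω ∂Q ≤ ENNReal.ofReal (Real.exp (m * (u * (x + δ)))) * Q N := by
    refine (setLIntegral_mono' hNmeas (g := fun _ => ENNReal.ofReal
      (Real.exp (m * (u * (x + δ))))) fun ω hω => ?_).trans_eq (by simp)
    refine ENNReal.ofReal_le_ofReal (Real.exp_le_exp.2 ?_)
    have := hω.2.le
    gcongr
  have h3' : ENNReal.ofReal (3 * b) ≤ ∫⁻ ω, g ω ∂Q := by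
    refine le_trans (ENNReal.ofReal_le_ofReal ?_) h3
    have : Real.exp (m * (s - κ)) = Real.exp (m * κ) * b := by
      rw [hb, ← Real.exp_add]; ring_nf
    rw [this]
    gcongr
  have h5 : ENNReal.ofReal b ≤ ∫⁻ ω in N, g ω ∂Q := by
    have h6 : ENNReal.ofReal b + ENNReal.ofReal (2 * b)
        ≤ ∫⁻ ω in N, g ω ∂Q + ENNReal.ofReal (2 * b) := by
      calc ENNReal.ofReal b + ENNReal.ofReal (2 * b) = ENNReal.ofReal (3 * b) := by
            rw [← ENNReal.ofReal_add (by positivity) (by positivity)]; ring_nf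
        _ ≤ _ := h3'
        _ ≤ _ := hsplit
        _ ≤ ∫⁻ ω in N, g ω ∂Q + (ENNReal.ofReal b + ENNReal.ofReal b) :=
            add_le_add_right (add_le_add h1 h2) _
        _ = _ := by rw [← ENNReal.ofReal_add (by positivity) (by positivity), two_mul]
    exact (ENNReal.add_le_add_iff_right ENNReal.ofReal_ne_top).1 h6
  have h7 := h5.trans hNg
  have h8 : ENNReal.ofReal (Real.exp (m * (u * (x + δ)))) * ENNReal.ofReal (Real.exp (m * c))
      ≤ ENNReal.ofReal b := by
    rw [← ENNReal.ofReal_mul (Real.exp_pos _).le, ← Real.exp_add]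
    refine ENNReal.ofReal_le_ofReal (Real.exp_le_exp.2 ?_)
    rw [← mul_add]
    gcongr
    linarith
  exact (ENNReal.mul_le_mul_iff_right (by simp [Real.exp_pos]) ENNReal.ofReal_ne_top).1
    (h8.trans h7)

theorem limsup_measure_nonpos [IsProbabilityMeasure Q] (A : ℕ → Set Ω) :
    limsup (fun m : ℕ => (((m : ℝ)⁻¹ : ℝ) : EReal) * ENNReal.log (Q (A m))) atTop ≤ 0 := by
  have := limsup_inv_mul_log_le (q := fun m => Q (A m)) (c := 0)
    (Eventually.of_forall fun m => by simpa using prob_le_one)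
  simpa using this

theorem HasLogMGFLimit.limsup_measure_ge_le [IsProbabilityMeasure Q] (H : HasLogMGFLimit α l Q Z)
    (hZ : ∀ m, Measurable (Z m)) (hα : α ∈ Set.Ioo (0 : ℝ) 1) (hl : 1 ≤ l) {x : ℝ} (hx : 0 ≤ x) :
    limsup (fun m : ℕ => (((m : ℝ)⁻¹ : ℝ) : EReal) * ENNReal.log (Q {ω | x ≤ Z m ω})) atTop
      ≤ -rateI α l x := by
  rw [EReal.le_neg]
  refine rateI_le hα hl hx ?_ fun s hs => ?_
  · rw [EReal.le_neg, neg_zero]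
    exact limsup_measure_nonpos _
  · rw [EReal.le_neg, ← EReal.coe_neg]
    refine EReal.le_of_forall_lt_iff_le.1 fun c hc => limsup_inv_mul_log_le ?_
    have hc' : -(invLambda α l s * x - s) < c := by exact_mod_cast hc
    exact H.measure_ge_le hZ hα hs (by linarith)

theorem liminf_log_mono {A B : ℕ → Set Ω} (h : ∀ m, A m ⊆ B m) :
    liminf (fun m : ℕ => (((m : ℝ)⁻¹ : ℝ) : EReal) * ENNReal.log (Q (A m))) atTop
      ≤ liminf (fun m : ℕ => (((m : ℝ)⁻¹ : ℝ) : EReal) * ENNReal.log (Q (B m))) atTop :=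
  liminf_le_liminf (Eventually.of_forall fun m => mul_le_mul_of_nonneg_left
    (ENNReal.log_monotone (measure_mono (h m)))
    (by exact_mod_cast (by positivity : (0 : ℝ) ≤ (m : ℝ)⁻¹))) (by isBoundedDefault)
    (by isBoundedDefault)

theorem limsup_log_mono {A B : ℕ → Set Ω} (h : ∀ m, A m ⊆ B m) :
    limsup (fun m : ℕ => (((m : ℝ)⁻¹ : ℝ) : EReal) * ENNReal.log (Q (A m))) atTop
      ≤ limsup (fun m : ℕ => (((m : ℝ)⁻¹ : ℝ) : EReal) * ENNReal.log (Q (B m))) atTop :=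
  limsup_le_limsup (Eventually.of_forall fun m => mul_le_mul_of_nonneg_left
    (ENNReal.log_monotone (measure_mono (h m)))
    (by exact_mod_cast (by positivity : (0 : ℝ) ≤ (m : ℝ)⁻¹))) (by isBoundedDefault)
    (by isBoundedDefault)

theorem HasLogMGFLimit.lower_bound_interior (H : HasLogMGFLimit α l Q Z)
    (hZ : ∀ m, Measurable (Z m)) (hα : α ∈ Set.Ioo (0 : ℝ) 1) (hl : 1 ≤ l) {x : ℝ}
    (hx : x ∈ Set.Ioo (0 : ℝ) (1 / (l : ℝ))) {G : Set ℝ} (hG : IsOpen G) (hxG : x ∈ G) :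
    -rateI α l x
      ≤ liminf (fun m : ℕ => (((m : ℝ)⁻¹ : ℝ) : EReal) * ENNReal.log (Q {ω | Z m ω ∈ G}))
        atTop := by
  obtain ⟨s, hs, hd⟩ := exists_hasDerivAt_invLambda hα hl hx
  have hu := invLambda_pos (l := l) hα hs
  have h1 : -rateI α l x ≤ ((s - invLambda α l s * x : ℝ) : EReal) := by
    rw [EReal.neg_le, ← EReal.coe_neg, neg_sub]
    exact invLambda_mul_sub_le_rateI hα hl x hs
  refine h1.trans (EReal.ge_of_forall_gt_iff_ge.1 fun c hc => ?_)
  have hc' : c < s - invLambda α l s * x := by exact_mod_cast hc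
  obtain ⟨ε, hε, hball⟩ := Metric.isOpen_iff.1 hG x hxG
  set δ := min (min ε (x / 2)) ((s - invLambda α l s * x - c) / (2 * invLambda α l s)) with hδ
  have hδ0 : 0 < δ := by
    refine lt_min (lt_min hε (by linarith [hx.1])) (div_pos (by linarith) (by linarith))
  have hδ1 : δ ≤ ε := (min_le_left _ _).trans (min_le_left _ _)
  have hδ2 : δ ≤ x / 2 := (min_le_left _ _).trans (min_le_right _ _)
  have hδ3 : δ * (2 * invLambda α l s) ≤ s - invLambda α l s * x - c := by
    rw [← le_div_iff₀ (by linarith)]; exact min_le_right _ _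
  refine (le_liminf_inv_mul_log (H.le_measure_Ioo hZ hα hs hx.1 hd hδ0 (by linarith [hx.1])
    (c := c) (by nlinarith))).trans (liminf_log_mono fun m ω hω => hball ?_)
  rw [Real.ball_eq_Ioo]
  exact ⟨by linarith [hω.1], by linarith [hω.2]⟩

/-- Because `Λ` has slope `0` at `0`, the probability of a neighbourhood of `0` tends to `1`. -/
theorem HasLogMGFLimit.lower_bound_zero [IsProbabilityMeasure Q] (H : HasLogMGFLimit α l Q Z)
    (hZ : ∀ m, Measurable (Z m)) (hZ0 : ∀ m ω, 0 ≤ Z m ω) (hα : α ∈ Set.Ioo (0 : ℝ) 1)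
    {G : Set ℝ} (hG : IsOpen G) (h0G : (0 : ℝ) ∈ G) :
    0 ≤ liminf (fun m : ℕ => (((m : ℝ)⁻¹ : ℝ) : EReal) * ENNReal.log (Q {ω | Z m ω ∈ G}))
      atTop := by
  obtain ⟨δ, hδ, hball⟩ := Metric.isOpen_iff.1 hG 0 h0G
  obtain ⟨s, hs, hlt⟩ := exists_lt_invLambda_mul (l := l) hα hδ
  set κ := (invLambda α l s * δ - s) / 2 with hκ
  have hκ0 : 0 < κ := by linarith
  have h1 := H.measure_ge_le hZ hα (x := δ) (c := -κ) hs (by linarith)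
  refine EReal.ge_of_forall_gt_iff_ge.1 fun c hc => ?_
  have hc' : c < 0 := by exact_mod_cast hc
  refine (le_liminf_inv_mul_log (q := fun m => Q {ω | Z m ω < δ}) ?_).trans
    (liminf_log_mono fun m ω (hω : Z m ω < δ) => hball ?_)
  · filter_upwards [h1, eventually_const_le_exp_mul 2 hκ0,
      eventually_const_le_exp_mul 2 (show 0 < -c by linarith)] with m h2 h3 h4
    have e1 : Real.exp (m * -κ) ≤ 1 / 2 := by
      rw [mul_neg, Real.exp_neg, one_div]; exact inv_anti₀ (by norm_num) h3
    have e2 : Real.exp (m * c) ≤ 1 / 2 := by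
      rw [show (m : ℝ) * c = -(m * -c) by ring, Real.exp_neg, one_div]
      exact inv_anti₀ (by norm_num) h4
    have hcompl : {ω | Z m ω < δ} = {ω | δ ≤ Z m ω}ᶜ := by ext; simp
    rw [hcompl, prob_compl_eq_one_sub (measurableSet_le measurable_const (hZ m))]
    calc ENNReal.ofReal (Real.exp (m * c)) ≤ ENNReal.ofReal (1 / 2) := ENNReal.ofReal_le_ofReal e2
      _ = 1 - ENNReal.ofReal (1 / 2) := by
        rw [← ENNReal.ofReal_one, ← ENNReal.ofReal_sub _ (by norm_num)]; norm_num
      _ ≤ _ := tsub_le_tsub_left (h2.trans (ENNReal.ofReal_le_ofReal e1)) _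
  · rw [Real.ball_eq_Ioo]
    exact ⟨by linarith [hZ0 m ω], by linarith⟩

/-- The Gärtner-Ellis theorem for the function `Λ`. -/
theorem HasLogMGFLimit.satisfiesLDP [IsProbabilityMeasure Q] (H : HasLogMGFLimit α l Q Z)
    (hZ : ∀ m, Measurable (Z m)) (hZ0 : ∀ m ω, 0 ≤ Z m ω) (hα : α ∈ Set.Ioo (0 : ℝ) 1)
    (hl : 1 ≤ l) : SatisfiesLDP Q Z (fun m => (m : ℝ)) (rateI α l) where
  nonneg := rateI_nonneg
  lowerSemicontinuous := lowerSemicontinuous_rateI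
  upper_bound F hF := by
    by_cases h0 : (0 : ℝ) ∈ F
    · refine (limsup_measure_nonpos _).trans ?_
      rw [EReal.le_neg, neg_zero, ← rateI_zero hα hl]
      exact iInf₂_le _ h0
    rcases (F ∩ Set.Ici 0).eq_empty_or_nonempty with he | hne
    · have h1 : ∀ m, {ω | Z m ω ∈ F} = ∅ := fun m =>
        Set.eq_empty_of_forall_notMem fun ω hω => by
          have : Z m ω ∈ F ∩ Set.Ici 0 := ⟨hω, hZ0 m ω⟩
          rw [he] at this; exact this
      have h2 : ∀ c : ℝ, limsup (fun m : ℕ => (((m : ℝ)⁻¹ : ℝ) : EReal)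
          * ENNReal.log (Q {ω | Z m ω ∈ F})) atTop ≤ c := fun c =>
        limsup_inv_mul_log_le (Eventually.of_forall fun m => by simp [h1 m])
      have h3 := EReal.eq_bot_iff_forall_lt _ |>.2 fun c =>
        (h2 (c - 1)).trans_lt (by exact_mod_cast (by linarith : c - 1 < c))
      rw [h3]
      exact bot_le
    · have hcl : IsClosed (F ∩ Set.Ici 0) := hF.inter isClosed_Ici
      have hbb : BddBelow (F ∩ Set.Ici 0) := ⟨0, fun y hy => hy.2⟩
      have hmem := hcl.csInf_mem hne hbb
      set x₀ := sInf (F ∩ Set.Ici 0)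
      refine (limsup_log_mono (B := fun m => {ω | x₀ ≤ Z m ω}) fun m ω hω =>
        csInf_le hbb ⟨hω, hZ0 m ω⟩).trans
        ((H.limsup_measure_ge_le hZ hα hl hmem.2).trans ?_)
      rw [EReal.neg_le_neg_iff]
      exact iInf₂_le _ hmem.1
  lower_bound G hG := by
    rw [EReal.neg_le]
    refine le_iInf₂ fun x hx => ?_
    rw [EReal.neg_le]
    have hl' : (0 : ℝ) < l := by exact_mod_cast hl
    by_cases hxm : x ∈ Set.Icc (0 : ℝ) (1 / (l : ℝ))
    swap
    · rw [rateI_eq_top hα hl hxm]; exact bot_le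
    rcases hxm.1.eq_or_lt with rfl | hx0
    · rw [rateI_zero hα hl, neg_zero]
      exact H.lower_bound_zero hZ hZ0 hα hG hx
    rcases hxm.2.eq_or_lt with rfl | hx1
    · -- the rate at the endpoint dominates the rate at points of `G` just below it
      obtain ⟨ε, hε, hball⟩ := Metric.isOpen_iff.1 hG _ hx
      set y := 1 / (l : ℝ) - min (ε / 2) (1 / (2 * l)) with hy
      have hm0 : 0 < min (ε / 2) (1 / (2 * (l : ℝ))) := by positivity
      have hm1 := min_le_left (ε / 2) (1 / (2 * (l : ℝ)))
      have hm2 := min_le_right (ε / 2) (1 / (2 * (l : ℝ)))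
      have hhalf : 1 / (2 * (l : ℝ)) < 1 / l :=
        one_div_lt_one_div_of_lt hl' (by linarith)
      have hy0 : 0 < y := by linarith
      have hyG : y ∈ G := by
        refine hball ?_
        rw [Real.ball_eq_Ioo]
        constructor <;> linarith
      refine le_trans ?_ (H.lower_bound_interior hZ hα hl ⟨hy0, by linarith⟩ hG hyG)
      rw [EReal.neg_le_neg_iff]
      exact rateI_mono hα hl hy0.le (by linarith)
    · exact H.lower_bound_interior hZ hα hl ⟨hx0, hx1⟩ hG hx

theorem HasLogMGFLimit.tendsto_log_measure_gt [IsProbabilityMeasure Q]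
    (H : HasLogMGFLimit α l Q Z) (hZ : ∀ m, Measurable (Z m)) (hZ0 : ∀ m ω, 0 ≤ Z m ω)
    (hα : α ∈ Set.Ioo (0 : ℝ) 1) (hl : 1 ≤ l) {x : ℝ} (hx : 0 < x) (hxl : x ≠ 1 / l) :
    Tendsto (fun m : ℕ => (((m : ℝ)⁻¹ : ℝ) : EReal) * ENNReal.log (Q {ω | x < Z m ω})) atTop
      (𝓝 (-rateI α l x)) := by
  have hup : limsup (fun m : ℕ => (((m : ℝ)⁻¹ : ℝ) : EReal) * ENNReal.log (Q {ω | x < Z m ω}))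
      atTop ≤ -rateI α l x :=
    (limsup_log_mono (B := fun m => {ω | x ≤ Z m ω}) fun m ω (hω : x < Z m ω) => hω.le).trans
      (H.limsup_measure_ge_le hZ hα hl hx.le)
  refine tendsto_of_le_liminf_of_limsup_le ?_ hup (by isBoundedDefault) (by isBoundedDefault)
  rcases hxl.lt_or_gt with h | h
  · refine le_trans ?_ ((H.satisfiesLDP hZ hZ0 hα hl).lower_bound (Set.Ioi x) isOpen_Ioi)
    rw [EReal.neg_le_neg_iff]
    exact iInf_rateI_Ioi_le hα hl hx.le h
  · rw [rateI_eq_top hα hl fun h' => absurd h'.2 (not_le.2 h)]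
    exact bot_le

end LDP

/-! ### Power series of blocks -/

section RisingCoeff

/-- The coefficient `(q)_{(n)} / n!` of `x ^ n` in `(1 - x) ^ (-q)`. -/
noncomputable def risingCoeff (q : ℝ) (n : ℕ) : ℝ :=
  (ascPochhammer ℝ n).eval q / n.factorial

theorem risingCoeff_zero (q : ℝ) : risingCoeff q 0 = 1 := by simp [risingCoeff]

theorem risingCoeff_nonneg {q : ℝ} (hq : 0 < q) (n : ℕ) : 0 ≤ risingCoeff q n :=
  div_nonneg (ascPochhammer_pos n q hq).le (by positivity)

theorem risingCoeff_one (n : ℕ) : risingCoeff 1 n = 1 := by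
  rw [risingCoeff, ascPochhammer_eval_one, div_self (by positivity)]

theorem add_one_mul_risingCoeff (q : ℝ) (n : ℕ) :
    ((n : ℝ) + 1) * risingCoeff q (n + 1) = q * risingCoeff (q + 1) n := by
  rw [risingCoeff, risingCoeff, ascPochhammer_succ_left, Nat.factorial_succ]
  simp only [Polynomial.eval_mul, Polynomial.eval_X, Polynomial.eval_comp, Polynomial.eval_add,
    Polynomial.eval_one]
  push_cast
  field_simp

theorem one_le_risingCoeff {q : ℝ} (hq : 1 ≤ q) (n : ℕ) : 1 ≤ risingCoeff q n := by
  rw [risingCoeff, one_le_div (by positivity)]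
  induction n with
  | zero => simp
  | succ n ih =>
    rw [Nat.factorial_succ, mul_comm, ascPochhammer_succ_eval]
    push_cast
    exact mul_le_mul ih (by linarith) (by positivity) (le_trans (by positivity) ih)

theorem hasSum_risingCoeff (q : ℝ) {x : ℝ} (hx : |x| < 1) :
    HasSum (fun n => risingCoeff q n * x ^ n) (1 / (1 - x) ^ q) := by
  have h := (Real.one_div_one_sub_rpow_hasFPowerSeriesOnBall_zero q).hasSum
    (y := x) (by simpa [enorm_eq_nnnorm] using! hx)
  simp only [zero_add, FormalMultilinearSeries.ofScalars_apply_eq, smul_eq_mul] at h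
  refine Eq.mp (congrArg (HasSum · _) (funext fun n => ?_)) h
  rw [Ring.choose, show q + n - 1 - n + 1 = q by ring]
  congr 1
  rw [risingCoeff, eq_div_iff (by positivity), mul_comm, ← nsmul_eq_mul,
    Ring.factorial_nsmul_multichoose_eq_ascPochhammer, Polynomial.ascPochhammer_smeval_eq_eval]

end RisingCoeff

section Series

open PowerSeries

theorem coeff_mul_nonneg {A B : ℝ⟦X⟧} (hA : ∀ n, 0 ≤ coeff n A) (hB : ∀ n, 0 ≤ coeff n B) (n : ℕ) :
    0 ≤ coeff n (A * B) := by
  rw [coeff_mul]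
  exact Finset.sum_nonneg fun p _ => mul_nonneg (hA _) (hB _)

theorem coeff_prod_nonneg {ι : Type*} (s : Finset ι) {A : ι → ℝ⟦X⟧}
    (hA : ∀ i ∈ s, ∀ n, 0 ≤ coeff n (A i)) (n : ℕ) : 0 ≤ coeff n (∏ i ∈ s, A i) := by
  classical
  induction s using Finset.induction_on generalizing n with
  | empty => rw [Finset.prod_empty, coeff_one]; split_ifs <;> norm_num
  | insert i s hi ih =>
    rw [Finset.prod_insert hi]
    exact coeff_mul_nonneg (hA i (Finset.mem_insert_self _ _))
      (ih fun j hj => hA j (Finset.mem_insert_of_mem hj)) n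

theorem hasSum_coeff_mul {A B : ℝ⟦X⟧} {t a b : ℝ}
    (hsA : HasSum (fun n => coeff n A * t ^ n) a)
    (hsB : HasSum (fun n => coeff n B * t ^ n) b) :
    HasSum (fun n => coeff n (A * B) * t ^ n) (a * b) := by
  have e : ∀ n, coeff n (A * B) * t ^ n
      = ∑ p ∈ Finset.HasAntidiagonal.antidiagonal n,
          (coeff p.1 A * t ^ p.1) * (coeff p.2 B * t ^ p.2) := by
    intro n
    rw [coeff_mul, Finset.sum_mul]
    refine Finset.sum_congr rfl fun p hp => ?_
    rw [← Finset.HasAntidiagonal.mem_antidiagonal.1 hp, pow_add]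
    ring
  have hA' : Summable fun n => ‖coeff n A * t ^ n‖ := hsA.summable.norm
  have hB' : Summable fun n => ‖coeff n B * t ^ n‖ := hsB.summable.norm
  simp only [e]
  rw [← hsA.tsum_eq, ← hsB.tsum_eq,
    tsum_mul_tsum_eq_tsum_sum_antidiagonal_of_summable_norm hA' hB']
  exact (summable_norm_sum_mul_antidiagonal_of_summable_norm hA' hB').of_norm.hasSum

theorem hasSum_coeff_one (t : ℝ) : HasSum (fun n => coeff n (1 : ℝ⟦X⟧) * t ^ n) 1 := by
  convert hasSum_ite_eq 0 (1 : ℝ) using 2 with n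
  rw [coeff_one]
  split_ifs with h <;> simp [h]

theorem hasSum_coeff_pow {A : ℝ⟦X⟧} {t a : ℝ} (hA : ∀ n, 0 ≤ coeff n A)
    (hsA : HasSum (fun n => coeff n A * t ^ n) a) (d : ℕ) :
    (∀ n, 0 ≤ coeff n (A ^ d)) ∧ HasSum (fun n => coeff n (A ^ d) * t ^ n) (a ^ d) := by
  induction d with
  | zero =>
    refine ⟨fun n => ?_, by simpa using hasSum_coeff_one t⟩
    rw [pow_zero, coeff_one]; split_ifs <;> norm_num
  | succ d ih =>
    simp only [pow_succ]
    exact ⟨coeff_mul_nonneg ih.1 hA, hasSum_coeff_mul ih.2 hsA⟩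

theorem summable_coeff_prod {ι : Type*} (s : Finset ι) {A : ι → ℝ⟦X⟧} {t : ℝ}
    (hsA : ∀ i ∈ s, Summable (fun n => coeff n (A i) * t ^ n)) :
    Summable (fun n => coeff n (∏ i ∈ s, A i) * t ^ n) := by
  classical
  induction s using Finset.induction_on with
  | empty => simpa using (hasSum_coeff_one t).summable
  | insert i s hi ih =>
    rw [Finset.prod_insert hi]
    exact (hasSum_coeff_mul (hsA i (Finset.mem_insert_self _ _)).hasSum
      (ih fun j hj => hsA j (Finset.mem_insert_of_mem hj)).hasSum).summable

theorem coeff_pow_eq_zero_of_lt {A : ℝ⟦X⟧} (h0 : constantCoeff A = 0) {m d : ℕ} (h : m < d) :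
    coeff m (A ^ d) = 0 :=
  X_pow_dvd_iff.1 (pow_dvd_pow_of_dvd (X_dvd_iff.2 h0) d) m h

theorem coeff_subst_eq_sum {A : ℝ⟦X⟧} (h0 : constantCoeff A = 0) (f : ℝ⟦X⟧) (m : ℕ) :
    coeff m (f.subst A) = ∑ d ∈ Finset.range (m + 1), coeff d f * coeff m (A ^ d) := by
  rw [coeff_subst' (HasSubst.of_constantCoeff_zero' h0)]
  refine finsum_eq_sum_of_support_subset _ fun d hd => ?_
  rw [Finset.coe_range, Set.mem_Iio]
  by_contra h
  refine hd ?_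
  simp only
  rw [coeff_pow_eq_zero_of_lt h0 (by omega), smul_zero]

theorem derivative_prod {ι : Type*} [DecidableEq ι] (s : Finset ι) (f : ι → ℝ⟦X⟧) :
    derivative ℝ (∏ i ∈ s, f i) = ∑ i ∈ s, (∏ j ∈ s.erase i, f j) * derivative ℝ (f i) := by
  induction s using Finset.induction_on with
  | empty => simp
  | insert i s hi ih =>
    rw [Finset.prod_insert hi, Derivation.leibniz, ih, Finset.sum_insert hi,
      Finset.erase_insert hi, smul_eq_mul, smul_eq_mul, Finset.mul_sum, add_comm]
    congr 1
    refine Finset.sum_congr rfl fun j hj => ?_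
    have hij : i ≠ j := fun h => hi (h ▸ hj)
    rw [Finset.erase_insert_of_ne hij,
      Finset.prod_insert (fun h => hi (Finset.mem_of_mem_erase h)), mul_assoc]

/-- The series `(1 - x) ^ (-q)`. -/
noncomputable def risingSeries (q : ℝ) : ℝ⟦X⟧ := PowerSeries.mk (risingCoeff q)

theorem derivative_risingSeries (q : ℝ) :
    derivative ℝ (risingSeries q) = C q * risingSeries (q + 1) := by
  ext n
  rw [coeff_derivative, coeff_C_mul, risingSeries, risingSeries, coeff_mk, coeff_mk,
    ← add_one_mul_risingCoeff, mul_comm]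

variable (α : ℝ) (l : ℕ) (u : ℝ)

/-- The exponential generating function of the future of a block of current size `r`: the
coefficient of `x ^ k` is `(r - α)_{(k)} / k!`, weighted by `u` if the final size `r + k` is `l`. -/
noncomputable def blockSeries (r : ℕ) : ℝ⟦X⟧ :=
  PowerSeries.mk fun k => risingCoeff (r - α) k * if r + k = l then u else 1

/-- The series `g`: `α` times the exponential generating function of a block that is still to
appear, weighted by `u` if the final size is `l`. Its coefficient of `x ^ k` is
`α (1 - α)_{(k - 1)} / k!` for `k ≥ 1`, up to the weight. -/
noncomputable def newBlockSeries : ℝ⟦X⟧ :=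
  PowerSeries.mk fun k =>
    if k = 0 then 0 else α * risingCoeff (1 - α) (k - 1) / k * if k = l then u else 1

/-- The series `(1 - g) ^ (-q)`, with `g = newBlockSeries α l u`. -/
noncomputable def newBlocksSeries (q : ℝ) : ℝ⟦X⟧ :=
  (risingSeries q).subst (newBlockSeries α l u)

variable {α l u}

theorem derivative_blockSeries (r : ℕ) :
    derivative ℝ (blockSeries α l u r) = C ((r : ℝ) - α) * blockSeries α l u (r + 1) := by
  ext n
  rw [coeff_derivative, coeff_C_mul, blockSeries, blockSeries, coeff_mk, coeff_mk]
  have h := add_one_mul_risingCoeff ((r : ℝ) - α) n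
  rw [show (r : ℝ) - α + 1 = (r + 1 : ℕ) - α by push_cast; ring] at h
  rw [← mul_assoc, ← h, show r + 1 + n = r + (n + 1) by ring]
  ring

theorem constantCoeff_newBlockSeries : constantCoeff (newBlockSeries α l u) = 0 := by
  rw [← coeff_zero_eq_constantCoeff_apply, newBlockSeries, coeff_mk, if_pos rfl]

theorem derivative_newBlockSeries :
    derivative ℝ (newBlockSeries α l u) = C α * blockSeries α l u 1 := by
  ext n
  rw [coeff_derivative, coeff_C_mul, blockSeries, newBlockSeries, coeff_mk, coeff_mk,
    if_neg (Nat.succ_ne_zero n), Nat.add_sub_cancel, Nat.cast_one, add_comm 1 n]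
  push_cast
  field_simp

theorem derivative_newBlocksSeries (q : ℝ) :
    derivative ℝ (newBlocksSeries α l u q)
      = C (q * α) * (blockSeries α l u 1 * newBlocksSeries α l u (q + 1)) := by
  have hs : HasSubst (newBlockSeries α l u) :=
    HasSubst.of_constantCoeff_zero' constantCoeff_newBlockSeries
  rw [newBlocksSeries, derivative_subst hs, derivative_risingSeries, derivative_newBlockSeries,
    ← smul_eq_C_mul, subst_smul hs, smul_eq_C_mul, newBlocksSeries, map_mul]
  ring

theorem coeff_blockSeries_nonneg (hα : α < 1) (hu : 0 ≤ u) {r : ℕ} (hr : 1 ≤ r) (n : ℕ) :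
    0 ≤ coeff n (blockSeries α l u r) := by
  rw [blockSeries, coeff_mk]
  have hr' : (1 : ℝ) ≤ r := by exact_mod_cast hr
  refine mul_nonneg (risingCoeff_nonneg (by linarith) n) ?_
  split_ifs <;> linarith

theorem coeff_newBlockSeries_nonneg (hα : α ∈ Set.Ioo (0 : ℝ) 1) (hu : 0 ≤ u) (n : ℕ) :
    0 ≤ coeff n (newBlockSeries α l u) := by
  rw [newBlockSeries, coeff_mk]
  have h1 := hα.1
  have h2 := risingCoeff_nonneg (show 0 < 1 - α by linarith [hα.2]) (n - 1)
  split_ifs <;> positivity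

theorem coeff_newBlockSeries_pow_nonneg (hα : α ∈ Set.Ioo (0 : ℝ) 1) (hu : 0 ≤ u) (d n : ℕ) :
    0 ≤ coeff n (newBlockSeries α l u ^ d) := by
  have := coeff_prod_nonneg (Finset.range d) (A := fun _ => newBlockSeries α l u)
    (fun _ _ => coeff_newBlockSeries_nonneg hα hu) n
  simpa using this

theorem coeff_newBlocksSeries (q : ℝ) (m : ℕ) :
    coeff m (newBlocksSeries α l u q)
      = ∑ d ∈ Finset.range (m + 1), risingCoeff q d * coeff m (newBlockSeries α l u ^ d) := by
  rw [newBlocksSeries, coeff_subst_eq_sum constantCoeff_newBlockSeries]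
  simp [risingSeries]

theorem coeff_newBlocksSeries_nonneg (hα : α ∈ Set.Ioo (0 : ℝ) 1) (hu : 0 ≤ u) {q : ℝ}
    (hq : 0 < q) (m : ℕ) : 0 ≤ coeff m (newBlocksSeries α l u q) := by
  rw [coeff_newBlocksSeries]
  exact Finset.sum_nonneg fun d _ =>
    mul_nonneg (risingCoeff_nonneg hq d) (coeff_newBlockSeries_pow_nonneg hα hu d m)

theorem hasSum_newBlockSeries (hl : 1 ≤ l) {t : ℝ} (ht : |t| < 1) :
    HasSum (fun n => coeff n (newBlockSeries α l u) * t ^ n)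
      (1 - (1 - t) ^ α + (u - 1) * blockCoeff α l * t ^ l) := by
  have h1 := hasSum_risingCoeff (-α) ht
  rw [Real.rpow_neg (by linarith [abs_lt.1 ht]), one_div, inv_inv] at h1
  have h2 := ((hasSum_ite_eq 0 (1 : ℝ)).sub h1).add
    (hasSum_ite_eq l ((u - 1) * blockCoeff α l * t ^ l))
  refine Eq.mp (congrArg (HasSum · _) (funext fun n => ?_)) h2
  symm
  rw [newBlockSeries, coeff_mk]
  rcases Nat.eq_zero_or_pos n with rfl | hn
  · simp [risingCoeff_zero, show (0 : ℕ) ≠ l by omega]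
  obtain ⟨k, rfl⟩ : ∃ k, n = k + 1 := ⟨n - 1, by omega⟩
  have h3 := add_one_mul_risingCoeff (-α) k
  rw [show -α + 1 = 1 - α by ring] at h3
  have h4 : risingCoeff (-α) (k + 1) = -(α * risingCoeff (1 - α) k / ((k : ℝ) + 1)) := by
    field_simp
    linarith
  rw [if_neg (Nat.succ_ne_zero k), if_neg (Nat.succ_ne_zero k), h4, Nat.add_sub_cancel]
  push_cast
  split_ifs with h
  · subst h
    have : blockCoeff α (k + 1) = α * risingCoeff (1 - α) k / ((k : ℝ) + 1) := by
      rw [blockCoeff, risingCoeff, Nat.add_sub_cancel, Nat.factorial_succ]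
      push_cast
      field_simp
    rw [this]
    ring
  · ring

/-- Where `g(t) < 1`, the coefficients of `(1 - g) ^ (-q)` are `O(t ^ (-m))`. -/
theorem exists_coeff_newBlocksSeries_mul_pow_le (hα : α ∈ Set.Ioo (0 : ℝ) 1) (hu : 0 ≤ u)
    {q : ℝ} (hq : 0 < q) {t a : ℝ} (ht : 0 ≤ t)
    (hs : HasSum (fun n => coeff n (newBlockSeries α l u) * t ^ n) a) (ha : a < 1) :
    ∃ C, ∀ m, coeff m (newBlocksSeries α l u q) * t ^ m ≤ C := by
  have hA := coeff_newBlockSeries_nonneg (l := l) hα hu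
  have ha0 : 0 ≤ a := hs.nonneg fun n => mul_nonneg (hA n) (by positivity)
  have hsum := hasSum_risingCoeff q (x := a) (by rwa [abs_of_nonneg ha0])
  refine ⟨1 / (1 - a) ^ q, fun m => ?_⟩
  · rw [coeff_newBlocksSeries, Finset.sum_mul]
    refine le_trans (Finset.sum_le_sum fun d _ => ?_) (sum_le_hasSum (Finset.range (m + 1))
      (fun d _ => mul_nonneg (risingCoeff_nonneg hq d) (by positivity)) hsum)
    rw [mul_assoc]
    obtain ⟨h1, h2⟩ := hasSum_coeff_pow hA hs d
    exact mul_le_mul_of_nonneg_left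
      (le_hasSum h2 m fun n _ => mul_nonneg (h1 n) (by positivity)) (risingCoeff_nonneg hq d)

/-- Up to a factor of order `m`, the coefficients of `(1 - x) ^ (-q)` dominate those of
`1 / (1 - x)`, even for small `q`. -/
theorem add_one_mul_risingCoeff_ge {q : ℝ} (hq : 0 < q) {m d : ℕ} (h : d ≤ m) :
    min q 1 ≤ ((m : ℝ) + 1) * risingCoeff q d := by
  rcases Nat.eq_zero_or_pos d with rfl | hd
  · rw [risingCoeff_zero, mul_one]
    have : (0 : ℝ) ≤ m := by positivity
    linarith [min_le_right q 1]
  obtain ⟨k, rfl⟩ : ∃ k, d = k + 1 := ⟨d - 1, by omega⟩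
  have h1 := add_one_mul_risingCoeff q k
  have h2 := one_le_risingCoeff (show 1 ≤ q + 1 by linarith) k
  have h3 := risingCoeff_nonneg hq (k + 1)
  have h4 : ((k : ℝ) + 1) ≤ m := by exact_mod_cast h
  nlinarith [min_le_left q 1]

/-- The series `1 / (1 - g)` satisfies the renewal equation. -/
theorem newBlocksSeries_one :
    newBlocksSeries α l u 1 = 1 + newBlockSeries α l u * newBlocksSeries α l u 1 := by
  have hs : HasSubst (newBlockSeries α l u) :=
    HasSubst.of_constantCoeff_zero' constantCoeff_newBlockSeries
  have h : risingSeries 1 = 1 + X * risingSeries 1 := by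
    ext n
    rcases n with _ | n
    · simp [risingSeries, risingCoeff_zero]
    · simp [risingSeries, risingCoeff_one, coeff_succ_X_mul, coeff_one]
  have h' := congrArg (fun f => f.subst (newBlockSeries α l u)) h
  simp only [subst_add hs, subst_mul hs, subst_X hs] at h'
  rw [← coe_substAlgHom hs, map_one, coe_substAlgHom hs] at h'
  exact h'

/-- Solutions of a renewal equation whose increments have mass at least `1` at `t` grow at least
like `t ^ (-m)`. -/
theorem exists_le_coeff_newBlocksSeries_one_mul_pow (hα : α ∈ Set.Ioo (0 : ℝ) 1) (hu : 0 < u)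
    {t a : ℝ} (ht : 0 < t)
    (hs : HasSum (fun n => coeff n (newBlockSeries α l u) * t ^ n) a) (ha : 1 < a) :
    ∃ κ > 0, ∀ m, κ ≤ coeff m (newBlocksSeries α l u 1) * t ^ m := by
  set g := newBlockSeries α l u with hg
  set v := newBlocksSeries α l u 1 with hv
  have hg0 := coeff_newBlockSeries_nonneg (l := l) hα hu.le
  have hv0 := coeff_newBlocksSeries_nonneg (l := l) hα hu.le one_pos
  rw [← hg] at hg0
  rw [← hv] at hv0
  have hrec : ∀ m, coeff (m + 1) v
      = ∑ p ∈ Finset.HasAntidiagonal.antidiagonal (m + 1), coeff p.1 g * coeff p.2 v := by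
    intro m
    conv_lhs => rw [hv, newBlocksSeries_one]
    rw [map_add, coeff_one, if_neg (Nat.succ_ne_zero m), zero_add, coeff_mul]
  have hrec' : ∀ m, ∑ i ∈ Finset.range (m + 2), coeff i g * coeff (m + 1 - i) v
      = coeff (m + 1) v := by
    intro m
    rw [hrec, Finset.Nat.sum_antidiagonal_eq_sum_range_succ (fun i j => coeff i g * coeff j v)]
  have hg00 : coeff 0 g = 0 := by
    rw [coeff_zero_eq_constantCoeff_apply]; exact constantCoeff_newBlockSeries
  have hg1 : 0 < coeff 1 g := by
    rw [hg, newBlockSeries, coeff_mk]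
    have := hα.1
    rw [if_neg one_ne_zero, Nat.sub_self, risingCoeff_zero]
    split_ifs <;> simp <;> positivity
  have hvpos : ∀ m, 0 < coeff m v := by
    intro m
    induction m with
    | zero =>
      rw [hv, coeff_newBlocksSeries]; simp [risingCoeff_zero]
    | succ m ih =>
      rw [← hrec']
      refine lt_of_lt_of_le (mul_pos hg1 ih) ?_
      exact Finset.single_le_sum (f := fun i => coeff i g * coeff (m + 1 - i) v)
        (fun i _ => mul_nonneg (hg0 i) (hv0 _)) (by simp : 1 ∈ Finset.range (m + 2))
  -- already finitely many increments have mass at least `1` at `t`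
  obtain ⟨L, hL⟩ := (hs.tendsto_sum_nat.eventually_const_lt ha).exists
  set κ := (Finset.range (L + 1)).inf' Finset.nonempty_range_add_one
    (fun m => coeff m v * t ^ m) with hκ
  have hκ0 : 0 < κ := by
    rw [hκ, Finset.lt_inf'_iff]
    exact fun m _ => mul_pos (hvpos m) (by positivity)
  refine ⟨κ, hκ0, fun m => ?_⟩
  induction m using Nat.strong_induction_on with
  | _ m ih =>
    rcases lt_or_ge m (L + 1) with hm | hm
    · exact Finset.inf'_le (fun m => coeff m v * t ^ m) (Finset.mem_range.2 hm)
    obtain ⟨m, rfl⟩ : ∃ k, m = k + 1 := ⟨m - 1, by omega⟩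
    rw [← hrec', Finset.sum_mul]
    calc κ ≤ κ * ∑ i ∈ Finset.range L, coeff i g * t ^ i := le_mul_of_one_le_right hκ0.le hL.le
      _ = ∑ i ∈ Finset.range L, (coeff i g * t ^ i) * κ := by rw [mul_comm, Finset.sum_mul]
      _ ≤ ∑ i ∈ Finset.range L, coeff i g * coeff (m + 1 - i) v * t ^ (m + 1) := by
        refine Finset.sum_le_sum fun i hi => ?_
        have hi' := Finset.mem_range.1 hi
        rcases Nat.eq_zero_or_pos i with rfl | hi0
        · simp [hg00]
        have h1 := ih (m + 1 - i) (by omega)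
        have h2 : t ^ (m + 1) = t ^ i * t ^ (m + 1 - i) := by
          rw [← pow_add]; congr 1; omega
        rw [h2]
        calc (coeff i g * t ^ i) * κ
            ≤ (coeff i g * t ^ i) * (coeff (m + 1 - i) v * t ^ (m + 1 - i)) :=
              mul_le_mul_of_nonneg_left h1 (mul_nonneg (hg0 i) (by positivity))
          _ = _ := by ring
      _ ≤ _ := by
        refine Finset.sum_le_sum_of_subset_of_nonneg (fun i hi => ?_) fun i _ _ =>
          mul_nonneg (mul_nonneg (hg0 i) (hv0 _)) (by positivity)
        have := Finset.mem_range.1 hi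
        exact Finset.mem_range.2 (by omega)

theorem exists_le_coeff_newBlocksSeries_mul_pow (hα : α ∈ Set.Ioo (0 : ℝ) 1) (hu : 0 < u)
    {q : ℝ} (hq : 0 < q) {t a : ℝ} (ht : 0 < t)
    (hs : HasSum (fun n => coeff n (newBlockSeries α l u) * t ^ n) a) (ha : 1 < a) :
    ∃ κ > 0, ∀ m : ℕ, κ ≤ (m + 1) * (coeff m (newBlocksSeries α l u q) * t ^ m) := by
  obtain ⟨κ, hκ, h⟩ := exists_le_coeff_newBlocksSeries_one_mul_pow hα hu ht hs ha
  have hq1 : 0 < min q 1 := lt_min hq one_pos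
  refine ⟨min q 1 * κ, mul_pos hq1 hκ, fun m => ?_⟩
  have h1 : min q 1 * coeff m (newBlocksSeries α l u 1)
      ≤ (m + 1) * coeff m (newBlocksSeries α l u q) := by
    rw [coeff_newBlocksSeries, coeff_newBlocksSeries, Finset.mul_sum, Finset.mul_sum]
    refine Finset.sum_le_sum fun d hd => ?_
    rw [risingCoeff_one, one_mul, ← mul_assoc]
    exact mul_le_mul_of_nonneg_right
      (add_one_mul_risingCoeff_ge hq (Nat.lt_succ_iff.1 (Finset.mem_range.1 hd)))
      (coeff_newBlockSeries_pow_nonneg hα hu.le d m)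
  calc min q 1 * κ ≤ min q 1 * (coeff m (newBlocksSeries α l u 1) * t ^ m) :=
        mul_le_mul_of_nonneg_left (h m) hq1.le
    _ = (min q 1 * coeff m (newBlocksSeries α l u 1)) * t ^ m := by ring
    _ ≤ ((m + 1) * coeff m (newBlocksSeries α l u q)) * t ^ m :=
        mul_le_mul_of_nonneg_right h1 (by positivity)
    _ = _ := by ring

theorem summable_blockSeries (hα : α < 1) (hu : 1 ≤ u) {r : ℕ} (hr : 1 ≤ r) {t : ℝ} (ht : 0 ≤ t)
    (ht1 : t < 1) : Summable fun n => coeff n (blockSeries α l u r) * t ^ n := by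
  have hr' : (1 : ℝ) ≤ r := by exact_mod_cast hr
  have h := (hasSum_risingCoeff ((r : ℝ) - α) (x := t) (by rwa [abs_of_nonneg ht])).summable
  refine Summable.of_nonneg_of_le
    (fun n => mul_nonneg (coeff_blockSeries_nonneg hα (by linarith) hr n) (by positivity))
    (fun n => ?_) (h.mul_left u)
  rw [blockSeries, coeff_mk]
  have h1 := risingCoeff_nonneg (show 0 < (r : ℝ) - α by linarith) n
  have h2 : (if r + n = l then u else 1) ≤ u := by split_ifs <;> linarith
  calc risingCoeff (r - α) n * (if r + n = l then u else 1) * t ^ n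
      ≤ risingCoeff (r - α) n * u * t ^ n := by gcongr
    _ = _ := by ring

end Series

/-! ### Patterns of coincidences -/

section Partition

variable {S T : Type*}

open Classical in
theorem mem_distinctValues {x : ℕ → S} {n : ℕ} {y : S} :
    y ∈ distinctValues x n ↔ ∃ k < n, x k = y := by
  simp [distinctValues]

theorem apply_mem_distinctValues (x : ℕ → S) {n k : ℕ} (h : k < n) : x k ∈ distinctValues x n :=
  mem_distinctValues.2 ⟨k, h, rfl⟩

/-- The `k`-th term of `x` is the first occurrence of its value. -/
def IsFirst (x : ℕ → S) (k : ℕ) : Prop := ∀ a < k, x a ≠ x k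

theorem exists_isFirst (x : ℕ → S) (k : ℕ) : ∃ a ≤ k, x a = x k ∧ IsFirst x a := by
  classical
  have h : ∃ a, x a = x k := ⟨k, rfl⟩
  refine ⟨Nat.find h, Nat.find_min' h rfl, Nat.find_spec h, fun b hb hbx => ?_⟩
  exact Nat.find_min h hb (hbx.trans (Nat.find_spec h))

theorem IsFirst.eq {x : ℕ → S} {a b : ℕ} (ha : IsFirst x a) (hb : IsFirst x b) (h : x a = x b) :
    a = b := by
  rcases lt_trichotomy a b with h' | h' | h'
  · exact absurd h (hb a h')
  · exact h'
  · exact absurd h.symm (ha b h')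

open Classical in
theorem sum_distinctValues {M : Type*} [AddCommMonoid M] (x : ℕ → S) (n : ℕ) (h : S → M) :
    ∑ y ∈ distinctValues x n, h y = ∑ k ∈ Finset.range n, if IsFirst x k then h (x k) else 0 := by
  have hD : distinctValues x n = ((Finset.range n).filter (IsFirst x)).image x := by
    ext y
    rw [mem_distinctValues, Finset.mem_image]
    constructor
    · rintro ⟨k, hk, rfl⟩
      obtain ⟨a, ha, hax, haf⟩ := exists_isFirst x k
      exact ⟨a, by simp [haf, ha.trans_lt hk], hax⟩
    · rintro ⟨k, hk, rfl⟩
      rw [Finset.mem_filter, Finset.mem_range] at hk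
      exact ⟨k, hk.1, rfl⟩
  rw [hD, Finset.sum_image, Finset.sum_filter]
  intro a ha b hb hab
  exact (Finset.mem_filter.1 ha).2.eq (Finset.mem_filter.1 hb).2 hab

open Classical in
/-- The indices below `n` at which a new value appears. -/
noncomputable def firstOccurrences (x : ℕ → S) (n : ℕ) : List ℕ :=
  (List.range n).filter (fun i => ∀ k < i, x k ≠ x i)

theorem mem_firstOccurrences {x : ℕ → S} {n k : ℕ} :
    k ∈ firstOccurrences x n ↔ k < n ∧ IsFirst x k := by
  simp [firstOccurrences, IsFirst]

theorem blockFrequencies_eq (x : ℕ → S) (n : ℕ) :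
    blockFrequencies x n = (firstOccurrences x n).map (fun i => frequency x n (x i)) := rfl

theorem nodup_map_firstOccurrences (x : ℕ → S) (n : ℕ) :
    ((firstOccurrences x n).map x).Nodup := by
  refine (List.nodup_map_iff_inj_on (List.nodup_range.filter _)).2 fun a ha b hb hab => ?_
  exact (mem_firstOccurrences.1 ha).2.eq (mem_firstOccurrences.1 hb).2 hab

open Classical in
theorem toFinset_map_firstOccurrences (x : ℕ → S) (n : ℕ) :
    ((firstOccurrences x n).map x).toFinset = distinctValues x n := by
  ext y
  rw [List.mem_toFinset, List.mem_map, mem_distinctValues]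
  constructor
  · rintro ⟨k, hk, rfl⟩
    exact ⟨k, (mem_firstOccurrences.1 hk).1, rfl⟩
  · rintro ⟨k, hk, rfl⟩
    obtain ⟨a, ha, hax, haf⟩ := exists_isFirst x k
    exact ⟨a, mem_firstOccurrences.2 ⟨ha.trans_lt hk, haf⟩, hax⟩

theorem numBlocks_eq_length (x : ℕ → S) (n : ℕ) :
    numBlocks x n = (blockFrequencies x n).length := by
  classical
  rw [numBlocks, ← toFinset_map_firstOccurrences,
    List.toFinset_card_of_nodup (nodup_map_firstOccurrences x n), blockFrequencies_eq,
    List.length_map, List.length_map]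

theorem prod_distinctValues {M : Type*} [CommMonoid M] (x : ℕ → S) (n : ℕ) (h : ℕ → M) :
    ∏ y ∈ distinctValues x n, h (frequency x n y) = ((blockFrequencies x n).map h).prod := by
  classical
  rw [← toFinset_map_firstOccurrences, List.prod_toFinset _ (nodup_map_firstOccurrences x n),
    blockFrequencies_eq, List.map_map, List.map_map]
  rfl

/-- Two sequences (possibly with values in different types) have the same pattern of coincidences
among their first `n` terms. -/
def SamePattern (n : ℕ) (x : ℕ → S) (y : ℕ → T) : Prop :=
  ∀ a < n, ∀ b < n, (x a = x b ↔ y a = y b)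

theorem SamePattern.mono {n m : ℕ} {x : ℕ → S} {y : ℕ → T} (h : SamePattern n x y) (hm : m ≤ n) :
    SamePattern m x y := fun a ha b hb => h a (ha.trans_le hm) b (hb.trans_le hm)

theorem samePattern_of_eq {n : ℕ} {x y : ℕ → S} (h : ∀ a < n, x a = y a) : SamePattern n x y :=
  fun a ha b hb => by rw [h a ha, h b hb]

theorem SamePattern.isFirst_iff {n : ℕ} {x : ℕ → S} {y : ℕ → T} (h : SamePattern n x y) {k : ℕ}
    (hk : k < n) : IsFirst x k ↔ IsFirst y k :=
  forall₂_congr fun a ha => not_congr (h a (ha.trans hk) k hk)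

theorem SamePattern.frequency_eq {n : ℕ} {x : ℕ → S} {y : ℕ → T} (h : SamePattern n x y) {k : ℕ}
    (hk : k < n) : frequency x n (x k) = frequency y n (y k) := by
  classical
  unfold frequency
  congr 1
  ext a
  simp only [Finset.mem_filter, Finset.mem_range]
  exact and_congr_right fun ha => h a ha k hk

theorem SamePattern.blockFrequencies_eq {n : ℕ} {x : ℕ → S} {y : ℕ → T} (h : SamePattern n x y) :
    blockFrequencies x n = blockFrequencies y n := by
  classical
  have h1 : firstOccurrences x n = firstOccurrences y n := by
    unfold firstOccurrences
    refine List.filter_congr fun k hk => ?_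
    have := h.isFirst_iff (List.mem_range.1 hk)
    unfold IsFirst at this
    simpa using this
  rw [_root_.blockFrequencies_eq, _root_.blockFrequencies_eq, h1]
  exact List.map_congr_left fun k hk => h.frequency_eq ((mem_firstOccurrences.1 hk).1)

theorem SamePattern.numBlocks_eq {n : ℕ} {x : ℕ → S} {y : ℕ → T} (h : SamePattern n x y) :
    numBlocks x n = numBlocks y n := by
  rw [numBlocks_eq_length, numBlocks_eq_length, h.blockFrequencies_eq]

/-- The function `f` depends only on the pattern of coincidences among the first `n` terms. -/
def PatternInvariant {β : Type*} (n : ℕ) (f : (ℕ → S) → β) : Prop :=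
  ∀ x y, SamePattern n x y → f x = f y

theorem PatternInvariant.exists_eq_comp {β : Type*} [Nonempty β] {n : ℕ} {f : (ℕ → S) → β}
    (hf : PatternInvariant n f) :
    ∃ g : (Fin n → Fin n → Prop) → β, ∀ x, f x = g fun a b => x a = x b := by
  have hfac : Function.FactorsThrough f (fun (x : ℕ → S) (a b : Fin n) => x a = x b) := by
    intro x y hxy
    refine hf x y fun a ha b hb => ?_
    exact iff_of_eq (congrFun (congrFun hxy ⟨a, ha⟩) ⟨b, hb⟩)
  exact ⟨Function.extend (fun (x : ℕ → S) (a b : Fin n) => x a = x b) f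
    (fun _ => Classical.arbitrary β), fun x => (hfac.extend_apply _ x).symm⟩

/-- There are finitely many patterns, so bounds for each pattern are uniform. -/
theorem PatternInvariant.finite_range {β : Type*} [Nonempty β] {n : ℕ} {f : (ℕ → S) → β}
    (hf : PatternInvariant n f) : (Set.range f).Finite := by
  obtain ⟨g, hg⟩ := hf.exists_eq_comp
  refine (Set.finite_range g).subset ?_
  rintro _ ⟨x, rfl⟩
  exact ⟨_, (hg x).symm⟩

theorem PatternInvariant.measurable {β Ω : Type*} [Nonempty β] [MeasurableSpace β]
    [MeasurableSpace Ω] [MeasurableSpace S] [MeasurableEq S] {n : ℕ} {f : (ℕ → S) → β}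
    (hf : PatternInvariant n f) {Y : ℕ → Ω → S} (hY : ∀ k, Measurable (Y k)) :
    Measurable fun ω => f fun k => Y k ω := by
  obtain ⟨g, hg⟩ := hf.exists_eq_comp
  simp only [hg]
  have h1 : Measurable fun ω => (fun a b : Fin n => Y a ω = Y b ω) :=
    measurable_pi_iff.2 fun a => measurable_pi_iff.2 fun b => (hY a).eq (hY b)
  exact (measurable_of_finite g).comp h1

theorem PatternInvariant.mono {β : Type*} {n m : ℕ} {f : (ℕ → S) → β} (hf : PatternInvariant n f)
    (h : n ≤ m) : PatternInvariant m f := fun x y hxy => hf x y (hxy.mono h)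

section Update

variable (x : ℕ → S) (i : ℕ) (y : S)

theorem samePattern_update {n : ℕ} (hn : n ≤ i) : SamePattern n (Function.update x i y) x :=
  samePattern_of_eq fun a ha => Function.update_of_ne (by omega) _ _

open Classical in
theorem distinctValues_update :
    distinctValues (Function.update x i y) (i + 1) = insert y (distinctValues x i) := by
  ext z
  rw [mem_distinctValues, Finset.mem_insert, mem_distinctValues]
  constructor
  · rintro ⟨k, hk, rfl⟩
    rcases (Nat.lt_succ_iff.1 hk).eq_or_lt with rfl | h
    · exact Or.inl (Function.update_self _ _ _)
    · exact Or.inr ⟨k, h, (Function.update_of_ne h.ne _ _).symm⟩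
  · rintro (rfl | ⟨k, hk, rfl⟩)
    · exact ⟨i, by omega, Function.update_self _ _ _⟩
    · exact ⟨k, by omega, Function.update_of_ne hk.ne _ _⟩

open Classical in
theorem frequency_update (z : S) :
    frequency (Function.update x i y) (i + 1) z = frequency x i z + if z = y then 1 else 0 := by
  unfold frequency
  rw [Finset.range_add_one, Finset.filter_insert, Function.update_self]
  have h : (Finset.range i).filter (fun a => Function.update x i y a = z)
      = (Finset.range i).filter (fun a => x a = z) := by
    refine Finset.filter_congr fun a ha => ?_
    rw [Function.update_of_ne (Finset.mem_range.1 ha).ne]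
  rw [h]
  by_cases hz : y = z
  · rw [if_pos hz, if_pos hz.symm, Finset.card_insert_of_notMem (by simp)]
  · rw [if_neg hz, if_neg (fun h => hz h.symm), add_zero]

theorem frequency_eq_zero {x : ℕ → S} {i : ℕ} {y : S} (hy : y ∉ distinctValues x i) :
    frequency x i y = 0 := by
  classical
  unfold frequency
  rw [Finset.card_eq_zero, Finset.filter_eq_empty_iff]
  intro a ha h
  exact hy (mem_distinctValues.2 ⟨a, Finset.mem_range.1 ha, h⟩)

theorem one_le_frequency {x : ℕ → S} {i : ℕ} {y : S} (hy : y ∈ distinctValues x i) :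
    1 ≤ frequency x i y := by
  classical
  obtain ⟨k, hk, rfl⟩ := mem_distinctValues.1 hy
  unfold frequency
  exact Finset.card_pos.2 ⟨k, by simp [hk]⟩

theorem one_le_numBlocks {x : ℕ → S} {i : ℕ} (hi : 1 ≤ i) : 1 ≤ numBlocks x i :=
  Finset.card_pos.2 ⟨x 0, apply_mem_distinctValues x hi⟩

end Update

end Partition

/-! ### The joint law of the past and the next draw -/

section Weights

variable {S : Type*} {α θ : ℝ}

/-- The predictive probability of a new value, given the first `i` terms of `x`. -/
noncomputable def newWeight (α θ : ℝ) (i : ℕ) (x : ℕ → S) : ℝ :=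
  (θ + numBlocks x i * α) / (θ + i)

/-- The predictive probability of the value `y`, given the first `i` terms of `x`. -/
noncomputable def oldWeight (α θ : ℝ) (i : ℕ) (x : ℕ → S) (y : S) : ℝ :=
  (frequency x i y - α) / (θ + i)

open Classical in
/-- The weight of the value `x k`, charged to the first index at which this value occurs. -/
noncomputable def indexWeight (α θ : ℝ) (i k : ℕ) (x : ℕ → S) : ℝ :=
  if IsFirst x k then oldWeight α θ i x (x k) else 0

theorem patternInvariant_newWeight (i : ℕ) :
    PatternInvariant i (newWeight α θ i : (ℕ → S) → ℝ) := fun x y h => by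
  rw [newWeight, newWeight, h.numBlocks_eq]

theorem patternInvariant_indexWeight {i k : ℕ} (hk : k < i) :
    PatternInvariant i (indexWeight α θ i k : (ℕ → S) → ℝ) := fun x y h => by
  classical
  unfold indexWeight oldWeight
  rw [h.frequency_eq hk]
  exact if_congr (h.isFirst_iff hk) rfl rfl

theorem newWeight_ge (hα : α ∈ Set.Ioo (0 : ℝ) 1) (hθ : -α < θ) {i : ℕ} (hi : 1 ≤ i) (x : ℕ → S) :
    (θ + α) / (θ + i) ≤ newWeight α θ i x := by
  have h1 : (1 : ℝ) ≤ numBlocks x i := by exact_mod_cast one_le_numBlocks hi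
  have h2 : (1 : ℝ) ≤ i := by exact_mod_cast hi
  have h3 : 0 < θ + i := by linarith [hα.2]
  unfold newWeight
  gcongr
  nlinarith [hα.1]

theorem newWeight_nonneg (hα : α ∈ Set.Ioo (0 : ℝ) 1) (hθ : -α < θ) {i : ℕ} (hi : 1 ≤ i)
    (x : ℕ → S) : 0 ≤ newWeight α θ i x := by
  have h2 : (1 : ℝ) ≤ i := by exact_mod_cast hi
  exact (div_nonneg (by linarith) (by linarith [hα.2])).trans (newWeight_ge hα hθ hi x)

theorem oldWeight_ge (hα : α ∈ Set.Ioo (0 : ℝ) 1) (hθ : -α < θ) {i : ℕ} (hi : 1 ≤ i) {x : ℕ → S}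
    {y : S} (hy : y ∈ distinctValues x i) : (1 - α) / (θ + i) ≤ oldWeight α θ i x y := by
  have h1 : (1 : ℝ) ≤ frequency x i y := by exact_mod_cast one_le_frequency hy
  have h2 : (1 : ℝ) ≤ i := by exact_mod_cast hi
  have h3 : 0 < θ + i := by linarith [hα.2]
  unfold oldWeight
  gcongr

theorem oldWeight_nonneg (hα : α ∈ Set.Ioo (0 : ℝ) 1) (hθ : -α < θ) {i : ℕ} (hi : 1 ≤ i)
    {x : ℕ → S} {y : S} (hy : y ∈ distinctValues x i) : 0 ≤ oldWeight α θ i x y := by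
  have h2 : (1 : ℝ) ≤ i := by exact_mod_cast hi
  exact (div_nonneg (by linarith [hα.2]) (by linarith [hα.2])).trans (oldWeight_ge hα hθ hi hy)

theorem indexWeight_nonneg (hα : α ∈ Set.Ioo (0 : ℝ) 1) (hθ : -α < θ) {i k : ℕ} (hi : 1 ≤ i)
    (hk : k < i) (x : ℕ → S) : 0 ≤ indexWeight α θ i k x := by
  unfold indexWeight
  split_ifs
  · exact oldWeight_nonneg hα hθ hi (apply_mem_distinctValues x hk)
  · exact le_rfl

end Weights

section JointLaw

variable {S Ω : Type*} [MeasurableSpace S] [MeasurableSpace Ω]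
  {ν : Measure S} [IsProbabilityMeasure ν] {P : Measure Ω} [IsProbabilityMeasure P] {α θ : ℝ}
  {X : ℕ → Ω → S}

/-- The first `i` terms of the sample. -/
def samplePrefix (X : ℕ → Ω → S) (i : ℕ) (ω : Ω) : Fin i → S := fun k => X k ω

theorem measurable_samplePrefix {S Ω : Type*} [MeasurableSpace S] [MeasurableSpace Ω]
    {X : ℕ → Ω → S} (hX : ∀ k, Measurable (X k)) (i : ℕ) :
    Measurable (samplePrefix X i) := measurable_pi_iff.2 fun k => hX k

/-- The predictive rule in integrated form: the probability that the first `i` terms lie in `B` and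
the next one in `A`. -/
theorem IsEwensPitmanSample.measure_inter (hX : IsEwensPitmanSample α θ ν P X)
    (hα : α ∈ Set.Ioo (0 : ℝ) 1) (hθ : -α < θ) {i : ℕ} (hi : 1 ≤ i) {B : Set (Fin i → S)}
    (hB : MeasurableSet B) {A : Set S} (hA : MeasurableSet A) :
    P (samplePrefix X i ⁻¹' B ∩ X i ⁻¹' A)
      = ∫⁻ ω in samplePrefix X i ⁻¹' B,
          (ENNReal.ofReal (newWeight α θ i fun k => X k ω) * ν A
            + ∑ k ∈ Finset.range i, ENNReal.ofReal (indexWeight α θ i k fun k => X k ω)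
              * (X k ⁻¹' A).indicator 1 ω) ∂P := by
  classical
  have hpm := measurable_samplePrefix hX.measurable i
  have hm : MeasurableSpace.comap (fun ω (k : Fin i) => X k ω) MeasurableSpace.pi
      ≤ (inferInstance : MeasurableSpace Ω) := hpm.comap_le
  have hAm : MeasurableSet (X i ⁻¹' A) := hX.measurable i hA
  have hpred := hX.predictive i hi A hA
  set m := MeasurableSpace.comap (fun ω (k : Fin i) => X k ω) MeasurableSpace.pi with hmdef
  have hint : Integrable ((X i ⁻¹' A).indicator (fun _ => (1 : ℝ))) P :=
    (integrable_const 1).indicator hAm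
  have hsB : MeasurableSet[m] (samplePrefix X i ⁻¹' B) := ⟨B, hB, rfl⟩
  -- the right-hand side of the predictive rule, as a sum over indices
  set g : Ω → ℝ := fun ω => newWeight α θ i (fun k => X k ω) * ν.real A
    + ∑ k ∈ Finset.range i, indexWeight α θ i k (fun k => X k ω)
      * (X k ⁻¹' A).indicator (fun _ => (1 : ℝ)) ω with hg
  have hg0 : ∀ ω, 0 ≤ g ω := fun ω => add_nonneg
    (mul_nonneg (newWeight_nonneg hα hθ hi _) measureReal_nonneg)
    (Finset.sum_nonneg fun k hk => mul_nonneg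
      (indexWeight_nonneg hα hθ hi (Finset.mem_range.1 hk) _)
      (Set.indicator_nonneg (fun _ _ => zero_le_one) _))
  have hpred' : P[(X i ⁻¹' A).indicator (fun _ => (1 : ℝ)) | m] =ᵐ[P] g := by
    refine hpred.trans (Eventually.of_forall fun ω => ?_)
    simp only [hg, newWeight]
    congr 1
    rw [sum_distinctValues, Finset.mul_sum]
    refine Finset.sum_congr rfl fun k _ => ?_
    unfold indexWeight oldWeight
    split_ifs
    · simp only [Set.indicator, Set.mem_preimage]
      ring
    · ring
  have hgint : Integrable g P := integrable_condExp.congr hpred'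
  have h1 : ∫ ω in samplePrefix X i ⁻¹' B, g ω ∂P
      = P.real (samplePrefix X i ⁻¹' B ∩ X i ⁻¹' A) := by
    rw [← setIntegral_congr_ae (hpm hB) (hpred'.mono fun ω h _ => h),
      setIntegral_condExp hm hint hsB, setIntegral_indicator hAm]
    simp
  rw [← ofReal_measureReal, ← h1, ofReal_integral_eq_lintegral_ofReal hgint.integrableOn
    (Eventually.of_forall hg0)]
  refine lintegral_congr fun ω => ?_
  simp only [hg]
  rw [ENNReal.ofReal_add (mul_nonneg (newWeight_nonneg hα hθ hi _) measureReal_nonneg)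
    (Finset.sum_nonneg fun k hk => mul_nonneg
      (indexWeight_nonneg hα hθ hi (Finset.mem_range.1 hk) _)
      (Set.indicator_nonneg (fun _ _ => zero_le_one) _)),
    ENNReal.ofReal_mul (newWeight_nonneg hα hθ hi _), ofReal_measureReal,
    ENNReal.ofReal_sum_of_nonneg fun k hk => mul_nonneg
      (indexWeight_nonneg hα hθ hi (Finset.mem_range.1 hk) _)
      (Set.indicator_nonneg (fun _ _ => zero_le_one) _)]
  congr 1
  refine Finset.sum_congr rfl fun k hk => ?_
  rw [ENNReal.ofReal_mul (indexWeight_nonneg hα hθ hi (Finset.mem_range.1 hk) _)]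
  congr 1
  by_cases h : ω ∈ X k ⁻¹' A <;> simp [h]

/-- The joint law of the first `i` terms and the next one. -/
theorem IsEwensPitmanSample.lintegral_prefix_next [MeasurableEq S]
    (hX : IsEwensPitmanSample α θ ν P X)
    (hα : α ∈ Set.Ioo (0 : ℝ) 1) (hθ : -α < θ) {i : ℕ} (hi : 1 ≤ i)
    {F : (Fin i → S) × S → ENNReal} (hF : Measurable F) :
    ∫⁻ ω, F (samplePrefix X i ω, X i ω) ∂P
      = ∫⁻ ω, (ENNReal.ofReal (newWeight α θ i fun k => X k ω)
            * ∫⁻ y, F (samplePrefix X i ω, y) ∂ν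
          + ∑ k ∈ Finset.range i, ENNReal.ofReal (indexWeight α θ i k fun k => X k ω)
              * F (samplePrefix X i ω, X k ω)) ∂P := by
  have hpm := measurable_samplePrefix hX.measurable i
  have hnew : Measurable fun ω => ENNReal.ofReal (newWeight α θ i fun k => X k ω) :=
    ((patternInvariant_newWeight i).measurable hX.measurable).ennreal_ofReal
  have hidx : ∀ k ∈ Finset.range i,
      Measurable fun ω => ENNReal.ofReal (indexWeight α θ i k fun k => X k ω) := fun k hk =>
    ((patternInvariant_indexWeight (Finset.mem_range.1 hk)).measurable
      hX.measurable).ennreal_ofReal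
  have hpair : ∀ k, Measurable fun ω => (samplePrefix X i ω, X k ω) := fun k =>
    hpm.prodMk (hX.measurable k)
  have hlaw : P.map (fun ω => (samplePrefix X i ω, X i ω))
      = ((P.withDensity fun ω => ENNReal.ofReal (newWeight α θ i fun k => X k ω)).map
          (samplePrefix X i)).prod ν
        + ∑ k ∈ Finset.range i,
          (P.withDensity fun ω => ENNReal.ofReal (indexWeight α θ i k fun k => X k ω)).map
            fun ω => (samplePrefix X i ω, X k ω) := by
    have : IsFiniteMeasure (P.map (fun ω => (samplePrefix X i ω, X i ω))) := by infer_instance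
    refine Measure.ext_prod fun {B A} hB hA => ?_
    rw [Measure.map_apply (hpair i) (hB.prod hA), Measure.add_apply, Measure.prod_prod,
      Measure.map_apply hpm hB, withDensity_apply _ (hpm hB), Measure.finsetSum_apply]
    have e1 : (fun ω => (samplePrefix X i ω, X i ω)) ⁻¹' B ×ˢ A
        = samplePrefix X i ⁻¹' B ∩ X i ⁻¹' A := rfl
    rw [e1, hX.measure_inter hα hθ hi hB hA, lintegral_add_left (hnew.mul_const _),
      lintegral_mul_const _ hnew, lintegral_finsetSum]
    · congr 1
      refine Finset.sum_congr rfl fun k hk => ?_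
      rw [Measure.map_apply (hpair k) (hB.prod hA),
        withDensity_apply _ (hpair k (hB.prod hA))]
      have e2 : (fun ω => (samplePrefix X i ω, X k ω)) ⁻¹' B ×ˢ A
          = X k ⁻¹' A ∩ samplePrefix X i ⁻¹' B := Set.inter_comm _ _
      have hkA := hX.measurable k hA
      rw [e2, ← Measure.restrict_restrict hkA, ← lintegral_indicator hkA]
      refine lintegral_congr fun ω => ?_
      by_cases h : ω ∈ X k ⁻¹' A <;> simp [h]
    · exact fun k hk => (hidx k hk).mul (measurable_one.indicator (hX.measurable k hA))
  have hin : Measurable fun ω => ∫⁻ y, F (samplePrefix X i ω, y) ∂ν :=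
    hF.lintegral_prod_right'.comp hpm
  have hmul : Measurable fun ω => ENNReal.ofReal (newWeight α θ i fun k => X k ω)
      * ∫⁻ y, F (samplePrefix X i ω, y) ∂ν := hnew.mul hin
  rw [← lintegral_map hF (hpair i), hlaw, lintegral_add_measure, lintegral_finsetSum_measure,
    lintegral_prod _ hF.aemeasurable, lintegral_map hF.lintegral_prod_right' hpm,
    lintegral_withDensity_eq_lintegral_mul _ hnew hin,
    lintegral_add_left hmul, lintegral_finsetSum]
  · congr 1
    refine Finset.sum_congr rfl fun k hk => ?_
    rw [lintegral_map hF (hpair k)]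
    exact lintegral_withDensity_eq_lintegral_mul _ (hidx k hk) (hF.comp (hpair k))
  · exact fun k hk => (hidx k hk).mul (hF.comp (hpair k))

end JointLaw

/-! ### Transitions and positivity of patterns -/

section Step

variable {S Ω : Type*} [MeasurableSpace S] [MeasurableEq S] [MeasurableSpace Ω]
  {ν : Measure S} [IsProbabilityMeasure ν] {P : Measure Ω} [IsProbabilityMeasure P] {α θ : ℝ}
  {X : ℕ → Ω → S}

/-- One step of the sampling scheme for a function of the pattern of coincidences. Since `ν` has no
atoms, a draw from `ν` is almost surely a new value. -/
theorem IsEwensPitmanSample.lintegral_step (hX : IsEwensPitmanSample α θ ν P X)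
    (hν : ∀ s, ν {s} = 0)
    (hα : α ∈ Set.Ioo (0 : ℝ) 1) (hθ : -α < θ) {i : ℕ} (hi : 1 ≤ i)
    {F Fnew : (ℕ → S) → ENNReal} (hF : PatternInvariant (i + 1) F)
    (hnew : ∀ x, ∀ y ∉ distinctValues x i, F (Function.update x i y) = Fnew x) :
    ∫⁻ ω, F (fun k => X k ω) ∂P
      = ∫⁻ ω, (ENNReal.ofReal (newWeight α θ i fun k => X k ω) * Fnew (fun k => X k ω)
          + ∑ y ∈ distinctValues (fun k => X k ω) i,
              ENNReal.ofReal (oldWeight α θ i (fun k => X k ω) y)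
                * F (Function.update (fun k => X k ω) i y)) ∂P := by
  classical
  -- a sequence with prescribed first `i + 1` terms
  set Y : ℕ → (Fin i → S) × S → S := fun k p => if h : k < i then p.1 ⟨k, h⟩ else p.2 with hY
  have hYm : ∀ k, Measurable (Y k) := by
    intro k
    by_cases h : k < i
    · simp only [hY, h, dite_true]
      exact (measurable_pi_apply _).comp measurable_fst
    · simp only [hY, h, dite_false]
      exact measurable_snd
  have hYF : ∀ (ω : Ω) (y : S), F (fun k => Y k (samplePrefix X i ω, y))
      = F (Function.update (fun k => X k ω) i y) := by
    intro ω y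
    refine hF _ _ (samePattern_of_eq fun a ha => ?_)
    rcases (Nat.lt_succ_iff.1 ha).eq_or_lt with rfl | h
    · simp [hY]
    · simp [hY, h, h.ne, samplePrefix]
  have hmain := hX.lintegral_prefix_next hα hθ hi (hF.measurable hYm)
  simp only [hYF] at hmain
  have hself : ∀ ω, Function.update (fun k => X k ω) i (X i ω) = fun k => X k ω := fun ω =>
    Function.update_eq_self i (fun k => X k ω)
  simp only [hself] at hmain
  rw [hmain]
  refine lintegral_congr fun ω => ?_
  congr 1
  · congr 1
    have hae : ∀ᵐ y ∂ν, y ∉ distinctValues (fun k => X k ω) i := by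
      refine measure_mono_null (t := ⋃ s ∈ distinctValues (fun k => X k ω) i, {s}) ?_
        ((measure_biUnion_null_iff (Finset.countable_toSet _)).2 fun s _ => hν s)
      intro y hy
      simpa using hy
    rw [lintegral_congr_ae (hae.mono fun y hy => hnew _ y hy), lintegral_const, measure_univ,
      mul_one]
  · rw [sum_distinctValues]
    refine Finset.sum_congr rfl fun k _ => ?_
    unfold indexWeight
    split_ifs <;> simp

/-- Every pattern of coincidences has positive probability. -/
theorem IsEwensPitmanSample.measure_samePattern_ne_zero (hX : IsEwensPitmanSample α θ ν P X)
    (hν : ∀ s, ν {s} = 0) (hα : α ∈ Set.Ioo (0 : ℝ) 1) (hθ : -α < θ) (b : ℕ → ℕ) (i : ℕ) :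
    P {ω | SamePattern i (fun k => X k ω) b} ≠ 0 := by
  classical
  have hinv : ∀ i, PatternInvariant i (fun x : ℕ → S => SamePattern i x b) := by
    intro i x y h
    refine propext ⟨fun hx a ha c hc => ?_, fun hy a ha c hc => ?_⟩
    · rw [← h a ha c hc]; exact hx a ha c hc
    · rw [h a ha c hc]; exact hy a ha c hc
  have hmeas : ∀ i, MeasurableSet {ω | SamePattern i (fun k => X k ω) b} := fun i =>
    measurableSet_setOfPred.2 ((hinv i).measurable hX.measurable)
  have hone : P {ω | SamePattern 1 (fun k => X k ω) b} ≠ 0 := by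
    have : {ω | SamePattern 1 (fun k => X k ω) b} = Set.univ := by
      refine Set.eq_univ_of_forall fun ω a ha c hc => ?_
      obtain rfl : a = 0 := by omega
      obtain rfl : c = 0 := by omega
      simp
    rw [this, measure_univ]
    exact one_ne_zero
  rcases Nat.eq_zero_or_pos i with rfl | hi
  · exact fun h => hone (measure_mono_null (fun ω hω => hω.mono (Nat.zero_le 1)) h)
  induction i, hi using Nat.le_induction with
  | base => exact hone
  | succ i hi ih =>
    have hi1 : (1 : ℝ) ≤ i := by exact_mod_cast hi
    have hθi : 0 < θ + i := by linarith [hα.2]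
    set F : (ℕ → S) → ENNReal := fun x => if SamePattern (i + 1) x b then 1 else 0 with hF
    have hFinv : PatternInvariant (i + 1) F := fun x y h => by
      simp only [hF, hinv (i + 1) x y h]
    set Fnew : (ℕ → S) → ENNReal :=
      fun x => if SamePattern i x b ∧ IsFirst b i then 1 else 0 with hFnew
    have hupd : ∀ (x : ℕ → S) (y : S), SamePattern (i + 1) (Function.update x i y) b
        ↔ SamePattern i x b ∧ ∀ a < i, (x a = y ↔ b a = b i) := by
      intro x y
      constructor
      · intro h
        refine ⟨fun a ha c hc => ?_, fun a ha => ?_⟩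
        · have := h a (by omega) c (by omega)
          rwa [Function.update_of_ne ha.ne, Function.update_of_ne hc.ne] at this
        · have := h a (by omega) i (by omega)
          rwa [Function.update_of_ne ha.ne, Function.update_self] at this
      · rintro ⟨h1, h2⟩ a ha c hc
        rcases (Nat.lt_succ_iff.1 ha).eq_or_lt with rfl | ha'
        · rcases (Nat.lt_succ_iff.1 hc).eq_or_lt with rfl | hc'
          · simp
          · rw [Function.update_self, Function.update_of_ne hc'.ne, eq_comm, h2 c hc', eq_comm]
        · rcases (Nat.lt_succ_iff.1 hc).eq_or_lt with rfl | hc'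
          · rw [Function.update_self, Function.update_of_ne ha'.ne, h2 a ha']
          · rw [Function.update_of_ne ha'.ne, Function.update_of_ne hc'.ne, h1 a ha' c hc']
    have hnew : ∀ x, ∀ y ∉ distinctValues x i, F (Function.update x i y) = Fnew x := by
      intro x y hy
      simp only [hF, hFnew, hupd]
      refine if_congr (and_congr_right fun _ => forall₂_congr fun a ha => ?_) rfl rfl
      have : x a ≠ y := fun h => hy (h ▸ apply_mem_distinctValues x ha)
      simp [this]
    have hstep := hX.lintegral_step hν hα hθ hi hFinv hnew
    have hlhs : ∫⁻ ω, F (fun k => X k ω) ∂P = P {ω | SamePattern (i + 1) (fun k => X k ω) b} := by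
      rw [← lintegral_indicator_one (hmeas (i + 1))]
      refine lintegral_congr fun ω => ?_
      simp [hF, Set.indicator]
    rw [hlhs] at hstep
    -- the next term has the right pattern with probability at least `κ`
    set κ := min ((θ + α) / (θ + i)) ((1 - α) / (θ + i)) with hκ
    have hκ0 : 0 < κ := lt_min (div_pos (by linarith) hθi) (div_pos (by linarith [hα.2]) hθi)
    have hle : ENNReal.ofReal κ * P {ω | SamePattern i (fun k => X k ω) b}
        ≤ P {ω | SamePattern (i + 1) (fun k => X k ω) b} := by
      rw [hstep, ← lintegral_indicator_one (hmeas i),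
        ← lintegral_const_mul _ (measurable_one.indicator (hmeas i))]
      refine lintegral_mono fun ω => ?_
      by_cases hω : SamePattern i (fun k => X k ω) b
      swap
      · simp [Set.indicator, hω]
      have e1 : ({ω | SamePattern i (fun k => X k ω) b} : Set Ω).indicator
          (1 : Ω → ENNReal) ω = 1 := Set.indicator_of_mem hω _
      simp only [e1, mul_one]
      by_cases hb : IsFirst b i
      · refine le_add_right ?_
        simp only [hFnew, hω, hb, and_self, if_true, mul_one]
        exact ENNReal.ofReal_le_ofReal ((min_le_left _ _).trans (newWeight_ge hα hθ hi _))
      · refine le_add_left ?_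
        obtain ⟨a, ha, hab⟩ : ∃ a < i, b a = b i := by
          simpa [IsFirst] using hb
        refine le_trans ?_ (Finset.single_le_sum (fun y _ => zero_le)
          (apply_mem_distinctValues (fun k => X k ω) ha))
        have : F (Function.update (fun k => X k ω) i (X a ω)) = 1 := by
          simp only [hF, hupd]
          rw [if_pos]
          exact ⟨hω, fun c hc => by rw [hω c hc a ha, hab]⟩
        rw [this, mul_one]
        exact ENNReal.ofReal_le_ofReal ((min_le_right _ _).trans
          (oldWeight_ge hα hθ hi (apply_mem_distinctValues (fun k => X k ω) ha)))
    intro h0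
    rw [h0, nonpos_iff_eq_zero, mul_eq_zero] at hle
    rcases hle with h | h
    · exact absurd (ENNReal.ofReal_eq_zero.1 h) (not_le.2 hκ0)
    · exact ih h

end Step

section Realization

/-- Every list of positive integers is the list of block frequencies of some sequence. -/
theorem exists_blockFrequencies_eq (L : List ℕ) (hL : ∀ r ∈ L, 1 ≤ r) :
    ∃ b : ℕ → ℕ, (∀ k < L.sum, b k < L.length) ∧ blockFrequencies b L.sum = L := by
  classical
  induction L using List.reverseRecOn with
  | nil => exact ⟨fun _ => 0, by simp, by simp [blockFrequencies]⟩
  | append_singleton L r ih =>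
    obtain ⟨b, hb1, hb2⟩ := ih fun s hs => hL s (by simp [hs])
    have hr : 1 ≤ r := hL r (by simp)
    set n := L.sum with hn
    set b' : ℕ → ℕ := fun k => if k < n then b k else L.length with hb'
    have e1 : ∀ k < n, b' k = b k := fun k hk => if_pos hk
    have e2 : ∀ k, n ≤ k → b' k = L.length := fun k hk => if_neg (by omega)
    have hsum : (L ++ [r]).sum = n + r := by simp [hn]
    rw [hsum]
    have hpat : SamePattern n b' b := fun a ha c hc => by rw [e1 a ha, e1 c hc]
    have hfreq1 : ∀ k < n, frequency b' (n + r) (b' k) = frequency b' n (b' k) := by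
      intro k hk
      unfold frequency
      congr 1
      ext a
      simp only [Finset.mem_filter, Finset.mem_range]
      refine and_congr_left fun h => ⟨fun _ => ?_, fun h => by omega⟩
      by_contra h'
      rw [e2 a (by omega), e1 k hk] at h
      exact absurd (hb1 k hk) (by omega)
    have hfreq2 : frequency b' (n + r) (b' n) = r := by
      have : frequency b' (n + r) (b' n) = (Finset.Ico n (n + r)).card := by
        unfold frequency
        congr 1
        ext a
        simp only [Finset.mem_filter, Finset.mem_range, Finset.mem_Ico]
        constructor
        · rintro ⟨h1, h2⟩
          refine ⟨?_, h1⟩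
          by_contra h'
          rw [e1 a (by omega), e2 n le_rfl] at h2
          exact absurd (hb1 a (by omega)) (by omega)
        · rintro ⟨h1, h2⟩
          exact ⟨h2, by rw [e2 a h1, e2 n le_rfl]⟩
      rw [this, Nat.card_Ico]
      omega
    have hfirst : firstOccurrences b' (n + r) = firstOccurrences b' n ++ [n] := by
      obtain ⟨s, rfl⟩ : ∃ s, r = s + 1 := ⟨r - 1, by omega⟩
      unfold firstOccurrences
      rw [List.range_add, List.filter_append]
      congr 1
      rw [List.range_succ_eq_map, List.map_cons, List.filter_cons_of_pos, List.filter_eq_nil_iff.2]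
      · simp
      · intro a ha
        simp only [List.mem_map, List.mem_range] at ha
        obtain ⟨c, ⟨d, hd, rfl⟩, rfl⟩ := ha
        simp only [decide_eq_true_eq, not_forall, not_not]
        exact ⟨n, by omega, by rw [e2 n le_rfl, e2 _ (by omega)]⟩
      · simp only [add_zero, decide_eq_true_eq]
        intro k hk h
        rw [e1 k hk, e2 n le_rfl] at h
        exact absurd (hb1 k hk) (by omega)
    refine ⟨b', fun k hk => ?_, ?_⟩
    · rw [List.length_append, List.length_singleton]
      by_cases h : k < n
      · rw [e1 k h]; exact (hb1 k h).trans (by omega)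
      · rw [e2 k (by omega)]; omega
    · rw [blockFrequencies_eq, hfirst, List.map_append, List.map_singleton, hfreq2]
      congr 1
      rw [← hb2, ← hpat.blockFrequencies_eq, blockFrequencies_eq]
      exact List.map_congr_left fun k hk => hfreq1 k (mem_firstOccurrences.1 hk).1

end Realization

/-! ### The generating function of the future of a partition -/

section FutureSeries

open PowerSeries

variable {S : Type*}

/-- The exponential generating function of the future of the partition of the first `i` terms:
up to a factor, the coefficient of `x ^ m` is the conditional expectation of `u ^ M`, where `M` is
the number of blocks of size `l` after `m` further draws. -/
noncomputable def futureSeries (α θ : ℝ) (l : ℕ) (u : ℝ) (i : ℕ) (x : ℕ → S) : ℝ⟦X⟧ :=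
  newBlocksSeries α l u (θ / α + numBlocks x i)
    * ∏ y ∈ distinctValues x i, blockSeries α l u (frequency x i y)

variable {α θ : ℝ} {l : ℕ} {u : ℝ} {i : ℕ}

theorem patternInvariant_futureSeries (i : ℕ) :
    PatternInvariant i (futureSeries α θ l u i : (ℕ → S) → ℝ⟦X⟧) := fun x y h => by
  rw [futureSeries, futureSeries, prod_distinctValues, prod_distinctValues, h.numBlocks_eq,
    h.blockFrequencies_eq]

/-- The value of `futureSeries` after a new value has been drawn. -/
noncomputable def futureSeriesNew (α θ : ℝ) (l : ℕ) (u : ℝ) (i : ℕ) (x : ℕ → S) : ℝ⟦X⟧ :=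
  newBlocksSeries α l u (θ / α + numBlocks x i + 1)
    * (blockSeries α l u 1 * ∏ y ∈ distinctValues x i, blockSeries α l u (frequency x i y))

theorem futureSeries_update_new {x : ℕ → S} {y : S} (hy : y ∉ distinctValues x i) :
    futureSeries α θ l u (i + 1) (Function.update x i y) = futureSeriesNew α θ l u i x := by
  classical
  rw [futureSeries, futureSeriesNew, numBlocks, distinctValues_update, Finset.prod_insert hy,
    Finset.card_insert_of_notMem hy, frequency_update, frequency_eq_zero hy,
    if_pos rfl, ← numBlocks]
  congr 2
  · push_cast; ring
  · refine Finset.prod_congr rfl fun z hz => ?_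
    have : z ≠ y := fun h => hy (h ▸ hz)
    rw [frequency_update, if_neg this, add_zero]

open Classical in
theorem futureSeries_update_old {x : ℕ → S} {y : S} (hy : y ∈ distinctValues x i) :
    futureSeries α θ l u (i + 1) (Function.update x i y)
      = newBlocksSeries α l u (θ / α + numBlocks x i)
        * ((∏ z ∈ (distinctValues x i).erase y, blockSeries α l u (frequency x i z))
          * blockSeries α l u (frequency x i y + 1)) := by
  rw [futureSeries, numBlocks, distinctValues_update, Finset.insert_eq_of_mem hy, ← numBlocks,
    ← Finset.prod_erase_mul _ _ hy, frequency_update, if_pos rfl]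
  congr 2
  refine Finset.prod_congr rfl fun z hz => ?_
  rw [frequency_update, if_neg (Finset.ne_of_mem_erase hz), add_zero]

/-- The derivative of the generating function runs through the possible values of the next draw. -/
theorem derivative_futureSeries (hα : α ≠ 0) (x : ℕ → S) :
    derivative ℝ (futureSeries α θ l u i x)
      = C (θ + numBlocks x i * α) * futureSeriesNew α θ l u i x
        + ∑ y ∈ distinctValues x i, C ((frequency x i y : ℝ) - α)
            * futureSeries α θ l u (i + 1) (Function.update x i y) := by
  classical
  rw [futureSeries, Derivation.leibniz, derivative_newBlocksSeries, derivative_prod, add_comm,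
    smul_eq_mul, smul_eq_mul, Finset.mul_sum]
  congr 1
  · rw [futureSeriesNew, show (θ / α + numBlocks x i) * α = θ + numBlocks x i * α by field_simp]
    ring
  · refine Finset.sum_congr rfl fun y hy => ?_
    rw [futureSeries_update_old hy, derivative_blockSeries]
    ring

theorem coeff_succ_futureSeries (hα : α ≠ 0) (x : ℕ → S) (m : ℕ) :
    ((m : ℝ) + 1) * coeff (m + 1) (futureSeries α θ l u i x)
      = (θ + numBlocks x i * α) * coeff m (futureSeriesNew α θ l u i x)
        + ∑ y ∈ distinctValues x i, ((frequency x i y : ℝ) - α)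
            * coeff m (futureSeries α θ l u (i + 1) (Function.update x i y)) := by
  have h := congrArg (coeff m) (derivative_futureSeries (θ := θ) (l := l) (u := u) (i := i) hα x)
  rw [coeff_derivative, map_add, coeff_C_mul, map_sum] at h
  simp only [coeff_C_mul] at h
  rw [← h, mul_comm]

theorem div_add_numBlocks_pos (hα : α ∈ Set.Ioo (0 : ℝ) 1) (hθ : -α < θ) (hi : 1 ≤ i)
    (x : ℕ → S) : 0 < θ / α + numBlocks x i := by
  have h1 : (1 : ℝ) ≤ numBlocks x i := by exact_mod_cast one_le_numBlocks hi
  have h2 : -1 < θ / α := by rw [lt_div_iff₀ hα.1]; linarith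
  linarith

theorem coeff_prod_blockSeries_nonneg (hα : α ∈ Set.Ioo (0 : ℝ) 1) (hu : 0 ≤ u) (x : ℕ → S)
    (m : ℕ) :
    0 ≤ coeff m (∏ y ∈ distinctValues x i, blockSeries α l u (frequency x i y)) :=
  coeff_prod_nonneg _ (fun _ hy => coeff_blockSeries_nonneg hα.2 hu (one_le_frequency hy)) m

theorem coeff_futureSeries_nonneg (hα : α ∈ Set.Ioo (0 : ℝ) 1) (hθ : -α < θ) (hu : 0 ≤ u)
    (hi : 1 ≤ i) (x : ℕ → S) (m : ℕ) : 0 ≤ coeff m (futureSeries α θ l u i x) :=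
  coeff_mul_nonneg (coeff_newBlocksSeries_nonneg hα hu (div_add_numBlocks_pos hα hθ hi x))
    (coeff_prod_blockSeries_nonneg hα hu x) m

theorem coeff_futureSeriesNew_nonneg (hα : α ∈ Set.Ioo (0 : ℝ) 1) (hθ : -α < θ) (hu : 0 ≤ u)
    (hi : 1 ≤ i) (x : ℕ → S) (m : ℕ) : 0 ≤ coeff m (futureSeriesNew α θ l u i x) := by
  have := div_add_numBlocks_pos hα hθ hi x
  exact coeff_mul_nonneg (coeff_newBlocksSeries_nonneg hα hu (by linarith))
    (coeff_mul_nonneg (coeff_blockSeries_nonneg hα.2 hu le_rfl)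
      (coeff_prod_blockSeries_nonneg hα hu x)) m

theorem constantCoeff_blockSeries (r : ℕ) :
    constantCoeff (blockSeries α l u r) = if r = l then u else 1 := by
  rw [← coeff_zero_eq_constantCoeff_apply, blockSeries, coeff_mk, risingCoeff_zero, one_mul,
    add_zero]

theorem coeff_zero_futureSeries (x : ℕ → S) :
    coeff 0 (futureSeries α θ l u i x) = u ^ numBlocksWithFrequency x i l := by
  classical
  have h : coeff 0 (newBlocksSeries α l u (θ / α + numBlocks x i)) = 1 := by
    rw [coeff_newBlocksSeries]; simp [risingCoeff_zero]
  rw [coeff_zero_eq_constantCoeff_apply] at h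
  rw [coeff_zero_eq_constantCoeff_apply, futureSeries, map_mul, map_prod, h, one_mul]
  simp only [constantCoeff_blockSeries]
  rw [← Finset.prod_filter, Finset.prod_const]
  rfl

theorem patternInvariant_numBlocksWithFrequency (i l : ℕ) :
    PatternInvariant i (fun x : ℕ → S => numBlocksWithFrequency x i l) := fun x y h => by
  -- read the number of blocks off from the exponent of `u = 2`
  have h1 := coeff_zero_futureSeries (α := 1) (θ := 0) (l := l) (u := 2) (i := i) x
  rw [patternInvariant_futureSeries i x y h, coeff_zero_futureSeries] at h1
  exact (pow_right_injective₀ (by norm_num : (0 : ℝ) < 2) (by norm_num) h1).symm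

theorem exists_coeff_futureSeries_mul_pow_le (hα : α ∈ Set.Ioo (0 : ℝ) 1) (hθ : -α < θ)
    (hu : 1 ≤ u) (hi : 1 ≤ i) (x : ℕ → S) {t t₁ a : ℝ} (ht : 0 ≤ t) (htt : t < t₁) (ht₁ : t₁ < 1)
    (hs : HasSum (fun n => coeff n (newBlockSeries α l u) * t₁ ^ n) a) (ha : a < 1) :
    ∃ C, ∀ m, coeff m (futureSeries α θ l u i x) * t ^ m ≤ C := by
  have hu0 : 0 ≤ u := by linarith
  have ht₁0 : 0 < t₁ := ht.trans_lt htt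
  have hq := div_add_numBlocks_pos hα hθ hi x
  obtain ⟨C, hC⟩ := exists_coeff_newBlocksSeries_mul_pow_le hα hu0 hq ht₁0.le hs ha
  have hB0 := coeff_newBlocksSeries_nonneg (l := l) hα hu0 hq
  have h1 : Summable fun n =>
      coeff n (newBlocksSeries α l u (θ / α + numBlocks x i)) * t ^ n := by
    refine Summable.of_nonneg_of_le (fun n => mul_nonneg (hB0 n) (by positivity)) (fun n => ?_)
      ((summable_geometric_of_lt_one (by positivity) ((div_lt_one ht₁0).2 htt)).mul_left C)
    calc coeff n (newBlocksSeries α l u (θ / α + numBlocks x i)) * t ^ n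
        = coeff n (newBlocksSeries α l u (θ / α + numBlocks x i)) * t₁ ^ n * (t / t₁) ^ n := by
          rw [div_pow]; field_simp
      _ ≤ C * (t / t₁) ^ n := mul_le_mul_of_nonneg_right (hC n) (by positivity)
  have h2 : Summable fun n =>
      coeff n (∏ y ∈ distinctValues x i, blockSeries α l u (frequency x i y)) * t ^ n :=
    summable_coeff_prod _ fun y hy =>
      summable_blockSeries hα.2 hu (one_le_frequency hy) ht (htt.trans ht₁)
  have h3 := hasSum_coeff_mul h1.hasSum h2.hasSum
  -- a single term is at most the sum of the series
  exact ⟨_, fun m => le_hasSum h3 m fun n _ =>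
    mul_nonneg (coeff_futureSeries_nonneg hα hθ hu0 hi x n) (by positivity)⟩

theorem exists_le_coeff_futureSeries_mul_pow (hα : α ∈ Set.Ioo (0 : ℝ) 1) (hθ : -α < θ)
    (hu : 1 ≤ u) (hi : 1 ≤ i) (x : ℕ → S) {t a : ℝ} (ht : 0 < t)
    (hs : HasSum (fun n => coeff n (newBlockSeries α l u) * t ^ n) a) (ha : 1 < a) :
    ∃ C, ∀ m : ℕ, 1 ≤ C * ((m + 1) * (coeff m (futureSeries α θ l u i x) * t ^ m)) := by
  have hu0 : 0 < u := by linarith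
  have hq := div_add_numBlocks_pos hα hθ hi x
  obtain ⟨κ, hκ, h⟩ := exists_le_coeff_newBlocksSeries_mul_pow hα hu0 hq ht hs ha
  refine ⟨κ⁻¹, fun m => ?_⟩
  rw [inv_mul_eq_div, one_le_div hκ]
  refine (h m).trans ?_
  have hB0 := coeff_newBlocksSeries_nonneg (l := l) hα hu0.le hq
  have hO0 := coeff_prod_blockSeries_nonneg (l := l) (i := i) hα hu0.le x
  have h0 : 1 ≤ coeff 0 (∏ y ∈ distinctValues x i, blockSeries α l u (frequency x i y)) := by
    rw [coeff_zero_eq_constantCoeff_apply, map_prod]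
    simp only [constantCoeff_blockSeries]
    refine Finset.prod_induction _ (fun z => 1 ≤ z)
      (fun a b ha hb => one_le_mul_of_one_le_of_one_le ha hb) le_rfl fun y _ => ?_
    split_ifs <;> linarith
  have h1 : coeff m (newBlocksSeries α l u (θ / α + numBlocks x i))
      ≤ coeff m (futureSeries α θ l u i x) := by
    rw [futureSeries, coeff_mul]
    refine le_trans (le_mul_of_one_le_right (hB0 m) h0) ?_
    exact Finset.single_le_sum (f := fun p : ℕ × ℕ =>
      coeff p.1 (newBlocksSeries α l u (θ / α + numBlocks x i))
        * coeff p.2 (∏ y ∈ distinctValues x i, blockSeries α l u (frequency x i y)))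
      (fun p _ => mul_nonneg (hB0 _) (hO0 _))
      (Finset.HasAntidiagonal.mem_antidiagonal.2 (add_zero m) : (m, 0) ∈ _)
  gcongr

end FutureSeries

section Moments

open PowerSeries

variable {S Ω : Type*} [MeasurableSpace S] [MeasurableEq S] [MeasurableSpace Ω]
  {ν : Measure S} [IsProbabilityMeasure ν] {P : Measure Ω} [IsProbabilityMeasure P] {α θ : ℝ}
  {X : ℕ → Ω → S}

open Classical in
theorem IsEwensPitmanSample.lintegral_futureSeries_succ (hX : IsEwensPitmanSample α θ ν P X)
    (hν : ∀ s, ν {s} = 0) (hα : α ∈ Set.Ioo (0 : ℝ) 1) (hθ : -α < θ) {l : ℕ} {u : ℝ} (hu : 0 ≤ u)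
    {n i : ℕ} (hn : 1 ≤ n) (hni : n ≤ i) {E : (ℕ → S) → Prop} (hE : PatternInvariant n E) (m : ℕ) :
    ∫⁻ ω, (if E (fun k => X k ω) then
        ENNReal.ofReal (coeff m (futureSeries α θ l u (i + 1) fun k => X k ω)) else 0) ∂P
      = ENNReal.ofReal ((m + 1) / (θ + i))
        * ∫⁻ ω, (if E (fun k => X k ω) then
          ENNReal.ofReal (coeff (m + 1) (futureSeries α θ l u i fun k => X k ω)) else 0) ∂P := by
  have hi : 1 ≤ i := hn.trans hni
  have hi1 : (1 : ℝ) ≤ i := by exact_mod_cast hi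
  have hθi : 0 < θ + i := by linarith [hα.2]
  have hEu : ∀ (x : ℕ → S) (y : S), E (Function.update x i y) = E x := fun x y =>
    hE _ _ (samePattern_update x i y hni)
  have hstep := hX.lintegral_step hν hα hθ hi
    (F := fun x => if E x then
      ENNReal.ofReal (coeff m (futureSeries α θ l u (i + 1) x)) else 0)
    (Fnew := fun x => if E x then ENNReal.ofReal (coeff m (futureSeriesNew α θ l u i x)) else 0)
    (fun x y h => by
      simp only [hE.mono (hni.trans (Nat.le_succ i)) x y h,
        patternInvariant_futureSeries (i + 1) x y h])
    (fun x y hy => by simp only [hEu, futureSeries_update_new hy])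
  rw [hstep, ← lintegral_const_mul']
  swap
  · exact ENNReal.ofReal_ne_top
  refine lintegral_congr fun ω => ?_
  simp only [hEu]
  split_ifs with h
  swap
  · simp
  set x : ℕ → S := fun k => X k ω
  have hsum : ∑ y ∈ distinctValues x i, ENNReal.ofReal (oldWeight α θ i x y)
        * ENNReal.ofReal (coeff m (futureSeries α θ l u (i + 1) (Function.update x i y)))
      = ENNReal.ofReal (∑ y ∈ distinctValues x i, oldWeight α θ i x y
        * coeff m (futureSeries α θ l u (i + 1) (Function.update x i y))) := by
    rw [ENNReal.ofReal_sum_of_nonneg fun y hy => mul_nonneg (oldWeight_nonneg hα hθ hi hy)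
      (coeff_futureSeries_nonneg hα hθ hu (by omega) _ m)]
    exact Finset.sum_congr rfl fun y hy =>
      (ENNReal.ofReal_mul (oldWeight_nonneg hα hθ hi hy)).symm
  rw [hsum, ← ENNReal.ofReal_mul (newWeight_nonneg hα hθ hi x),
    ← ENNReal.ofReal_add (mul_nonneg (newWeight_nonneg hα hθ hi x)
      (coeff_futureSeriesNew_nonneg hα hθ hu hi x m))
      (Finset.sum_nonneg fun y hy => mul_nonneg (oldWeight_nonneg hα hθ hi hy)
        (coeff_futureSeries_nonneg hα hθ hu (by omega) _ m)),
    ← ENNReal.ofReal_mul (by positivity)]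
  congr 1
  rw [div_mul_eq_mul_div, coeff_succ_futureSeries hα.1.ne', add_div, Finset.sum_div]
  unfold newWeight oldWeight
  congr 1
  · ring
  · exact Finset.sum_congr rfl fun y _ => by ring

open Classical in
theorem IsEwensPitmanSample.lintegral_futureSeries_add (hX : IsEwensPitmanSample α θ ν P X)
    (hν : ∀ s, ν {s} = 0) (hα : α ∈ Set.Ioo (0 : ℝ) 1) (hθ : -α < θ) {l : ℕ} {u : ℝ} (hu : 0 ≤ u)
    {n : ℕ} (hn : 1 ≤ n) {E : (ℕ → S) → Prop} (hE : PatternInvariant n E) (a m : ℕ) :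
    ∫⁻ ω, (if E (fun k => X k ω) then
        ENNReal.ofReal (coeff m (futureSeries α θ l u (n + a) fun k => X k ω)) else 0) ∂P
      = ENNReal.ofReal ((∏ k ∈ Finset.range a, ((m : ℝ) + 1 + k))
          / ∏ k ∈ Finset.range a, (θ + n + k))
        * ∫⁻ ω, (if E (fun k => X k ω) then
          ENNReal.ofReal (coeff (m + a) (futureSeries α θ l u n fun k => X k ω)) else 0) ∂P := by
  have hn1 : (1 : ℝ) ≤ n := by exact_mod_cast hn
  induction a generalizing m with
  | zero => simp
  | succ a ih =>
    have hpos : ∀ k : ℕ, 0 < θ + n + k := fun k => by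
      have : (0 : ℝ) ≤ k := by positivity
      linarith [hα.2]
    have hθi : 0 < θ + (n + a : ℕ) := by push_cast; linarith [hpos a]
    rw [show n + (a + 1) = n + a + 1 by ring,
      hX.lintegral_futureSeries_succ hν hα hθ hu hn (by omega) hE m, ih (m + 1), ← mul_assoc,
      ← ENNReal.ofReal_mul (by positivity), show m + 1 + a = m + (a + 1) by ring]
    congr 2
    rw [Finset.prod_range_succ' (fun k : ℕ => (m : ℝ) + 1 + k), Finset.prod_range_succ]
    push_cast
    rw [div_mul_div_comm]
    congr 1
    · rw [mul_comm]
      congr 1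
      · exact Finset.prod_congr rfl fun k _ => by ring
      · ring
    · ring

/-- The moments of `u ^ M` on an event determined by the first `n` terms. -/
theorem IsEwensPitmanSample.setLIntegral_pow (hX : IsEwensPitmanSample α θ ν P X)
    (hν : ∀ s, ν {s} = 0) (hα : α ∈ Set.Ioo (0 : ℝ) 1) (hθ : -α < θ) {l : ℕ} {u : ℝ} (hu : 0 ≤ u)
    {n : ℕ} (hn : 1 ≤ n) {E : (ℕ → S) → Prop} (hE : PatternInvariant n E) (m : ℕ) :
    ∫⁻ ω in {ω | E fun k => X k ω},
        ENNReal.ofReal (u ^ numBlocksWithFrequency (fun k => X k ω) (n + m) l) ∂P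
      = ENNReal.ofReal (∏ k ∈ Finset.range m, ((k : ℝ) + 1) / (θ + n + k))
        * ∫⁻ ω in {ω | E fun k => X k ω},
          ENNReal.ofReal (coeff m (futureSeries α θ l u n fun k => X k ω)) ∂P := by
  classical
  have hEm : MeasurableSet {ω | E fun k => X k ω} :=
    measurableSet_setOfPred.2 (hE.measurable hX.measurable)
  have h := hX.lintegral_futureSeries_add hν hα hθ hu (l := l) hn hE m 0
  simp only [coeff_zero_futureSeries, zero_add, Nat.cast_zero] at h
  rw [← lintegral_indicator hEm, ← lintegral_indicator hEm, Finset.prod_div_distrib]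
  simp only [Set.indicator, Set.mem_ofPred_eq]
  rw [h]
  congr 4
  exact funext fun k => add_comm _ _

end Moments

/-! ### Growth of the moments -/

section Growth

open PowerSeries

variable {α θ : ℝ} {l : ℕ}

theorem hasSum_newBlockSeries_exp (hα : α ∈ Set.Ioo (0 : ℝ) 1) (hl : 1 ≤ l) {s r : ℝ} (hs : 0 < s)
    (hr : 0 < r) :
    HasSum (fun n => coeff n (newBlockSeries α l (Real.exp (invLambda α l s)))
        * Real.exp (-r) ^ n)
      (1 - (1 - Real.exp (-r)) ^ α + (1 - Real.exp (-s)) ^ α * Real.exp (l * (s - r))) := by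
  have ht : |Real.exp (-r)| < 1 := by
    rw [abs_of_pos (Real.exp_pos _), Real.exp_lt_one_iff]; linarith
  have hc := blockCoeff_pos (l := l) hα
  convert hasSum_newBlockSeries (α := α) (u := Real.exp (invLambda α l s)) hl ht using 2
  rw [exp_invLambda hα hs.le, ← Real.exp_nat_mul, show (l : ℝ) * (s - r) = l * s + l * -r by ring,
    Real.exp_add]
  field_simp
  ring

/-- Below `e^{-s}` the total mass of the renewal equation is less than `1`. -/
theorem newBlockSeries_mass_lt_one (hα : α ∈ Set.Ioo (0 : ℝ) 1) {s r : ℝ} (hs : 0 < s)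
    (hsr : s < r) :
    1 - (1 - Real.exp (-r)) ^ α + (1 - Real.exp (-s)) ^ α * Real.exp (l * (s - r)) < 1 := by
  have h1 := one_sub_exp_neg_pos hs
  have h2 : (1 - Real.exp (-s)) ^ α < (1 - Real.exp (-r)) ^ α :=
    Real.rpow_lt_rpow h1.le (by linarith [Real.exp_lt_exp.2 (neg_lt_neg hsr)]) hα.1
  have h3 : Real.exp (l * (s - r)) ≤ 1 :=
    Real.exp_le_one_iff.2 (mul_nonpos_of_nonneg_of_nonpos (by positivity) (by linarith))
  have h4 : 0 ≤ (1 - Real.exp (-s)) ^ α := by positivity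
  nlinarith

/-- Above `e^{-s}` the total mass of the renewal equation exceeds `1`. -/
theorem one_lt_newBlockSeries_mass (hα : α ∈ Set.Ioo (0 : ℝ) 1) {s r : ℝ} (hr : 0 < r)
    (hrs : r < s) :
    1 < 1 - (1 - Real.exp (-r)) ^ α + (1 - Real.exp (-s)) ^ α * Real.exp (l * (s - r)) := by
  have h1 := one_sub_exp_neg_pos hr
  have h2 : (1 - Real.exp (-r)) ^ α < (1 - Real.exp (-s)) ^ α :=
    Real.rpow_lt_rpow h1.le (by linarith [Real.exp_lt_exp.2 (neg_lt_neg hrs)]) hα.1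
  have h3 : 1 ≤ Real.exp (l * (s - r)) :=
    Real.one_le_exp (mul_nonneg (by positivity) (by linarith))
  have h4 : 0 ≤ (1 - Real.exp (-s)) ^ α := by
    have := one_sub_exp_neg_pos (hr.trans hrs)
    positivity
  nlinarith

/-- A bound that holds for each value of a function with finite range holds uniformly. -/
theorem exists_forall_of_finite_range {ι β : Type*} {f : ι → β} (hf : (Set.range f).Finite)
    {p : β → ℝ → Prop} (hp : ∀ b C C', p b C → C ≤ C' → p b C') (h : ∀ i, ∃ C, p (f i) C) :
    ∃ C, ∀ i, p (f i) C := by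
  have h' : ∀ b : Set.range f, ∃ C, p b C := by
    rintro ⟨_, i, rfl⟩; exact h i
  choose C hC using h'
  have := hf.to_subtype
  obtain ⟨D, hD⟩ := (Set.finite_range C).bddAbove
  exact ⟨D, fun i => hp _ _ _ (hC ⟨f i, i, rfl⟩) (hD ⟨_, rfl⟩)⟩

theorem exists_coeff_futureSeries_le {S : Type*} (hα : α ∈ Set.Ioo (0 : ℝ) 1) (hθ : -α < θ)
    (hl : 1 ≤ l) {n : ℕ} (hn : 1 ≤ n) {s r : ℝ} (hs : 0 < s) (hsr : s < r) :
    ∃ C, ∀ (x : ℕ → S) (m : ℕ),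
      coeff m (futureSeries α θ l (Real.exp (invLambda α l s)) n x) ≤ C * Real.exp (m * r) := by
  have hu : 1 ≤ Real.exp (invLambda α l s) := Real.one_le_exp (invLambda_pos hα hs).le
  obtain ⟨C, hC⟩ := exists_forall_of_finite_range
    (patternInvariant_futureSeries (S := S) (α := α) (θ := θ) (l := l)
      (u := Real.exp (invLambda α l s)) n).finite_range
    (p := fun A C => ∀ m, coeff m A * Real.exp (-r) ^ m ≤ C)
    (fun A C C' h hCC m => (h m).trans hCC)
    (fun x => exists_coeff_futureSeries_mul_pow_le hα hθ hu hn x (Real.exp_pos _).le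
      (Real.exp_lt_exp.2 (by linarith : -r < -((s + r) / 2)))
      (Real.exp_lt_one_iff.2 (by linarith))
      (hasSum_newBlockSeries_exp hα hl hs (by linarith))
      (newBlockSeries_mass_lt_one hα hs (by linarith)))
  refine ⟨C, fun x m => ?_⟩
  have h := hC x m
  rwa [← Real.exp_nat_mul, mul_neg, Real.exp_neg, ← div_eq_mul_inv,
    div_le_iff₀ (Real.exp_pos _)] at h

theorem exists_le_coeff_futureSeries {S : Type*} (hα : α ∈ Set.Ioo (0 : ℝ) 1) (hθ : -α < θ)
    (hl : 1 ≤ l) {n : ℕ} (hn : 1 ≤ n) {s r : ℝ} (hr : 0 < r) (hrs : r < s) :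
    ∃ κ > 0, ∀ (x : ℕ → S) (m : ℕ), κ * Real.exp (m * r) / (m + 1)
      ≤ coeff m (futureSeries α θ l (Real.exp (invLambda α l s)) n x) := by
  have hs : 0 < s := hr.trans hrs
  have hu : 1 ≤ Real.exp (invLambda α l s) := Real.one_le_exp (invLambda_pos hα hs).le
  have hnn : ∀ (x : ℕ → S) m, 0 ≤ coeff m (futureSeries α θ l (Real.exp (invLambda α l s)) n x) :=
    fun x m => coeff_futureSeries_nonneg hα hθ (by linarith) hn x m
  obtain ⟨C, hC⟩ := exists_forall_of_finite_range
    (patternInvariant_futureSeries (S := S) (α := α) (θ := θ) (l := l)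
      (u := Real.exp (invLambda α l s)) n).finite_range
    (p := fun A C => (∀ m, 0 ≤ coeff m A) →
      ∀ m : ℕ, 1 ≤ C * ((m + 1) * (coeff m A * Real.exp (-r) ^ m)))
    (fun A C C' h hCC hA m => (h hA m).trans (mul_le_mul_of_nonneg_right hCC
      (mul_nonneg (by positivity) (mul_nonneg (hA m) (by positivity)))))
    (fun x => by
      obtain ⟨C, hC⟩ := exists_le_coeff_futureSeries_mul_pow hα hθ hu hn x (Real.exp_pos _)
        (hasSum_newBlockSeries_exp hα hl hs hr) (one_lt_newBlockSeries_mass hα hr hrs)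
      exact ⟨C, fun _ => hC⟩)
  have hC1 : 0 < |C| + 1 := by positivity
  refine ⟨(|C| + 1)⁻¹, by positivity, fun x m => ?_⟩
  have h := hC x (hnn x) m
  rw [← Real.exp_nat_mul, mul_neg, Real.exp_neg, ← div_eq_mul_inv] at h
  rw [div_le_iff₀ (by positivity), inv_mul_le_iff₀ hC1]
  set A := coeff m (futureSeries α θ l (Real.exp (invLambda α l s)) n x)
  have h2 : 0 ≤ A := hnn x m
  have h3 : C * ((m + 1) * (A / Real.exp (m * r)))
      = C * (A * (m + 1)) / Real.exp (m * r) := by ring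
  rw [h3, le_div_iff₀ (Real.exp_pos _), one_mul] at h
  refine h.trans (mul_le_mul_of_nonneg_right ?_ (by positivity))
  linarith [le_abs_self C]

/-- The normalizing constants of the sampling model grow subexponentially. -/
theorem tendsto_inv_mul_log_prod {q : ℝ} (hq : 0 < q) :
    Tendsto (fun m : ℕ => (m : ℝ)⁻¹ * Real.log (∏ k ∈ Finset.range m, ((k : ℝ) + 1) / (q + k)))
      atTop (𝓝 0) := by
  have hpos : ∀ k : ℕ, 0 < ((k : ℝ) + 1) / (q + k) := fun k => by positivity
  have h1 : Tendsto (fun k : ℕ => ((k : ℝ) + 1) / (q + k)) atTop (𝓝 1) := by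
    have h2 : Tendsto (fun k : ℕ => 1 + (1 - q) / (q + k)) atTop (𝓝 (1 + 0)) :=
      tendsto_const_nhds.add (tendsto_const_nhds.div_atTop
        (tendsto_atTop_add_const_left _ _ tendsto_natCast_atTop_atTop))
    rw [add_zero] at h2
    refine h2.congr fun k => ?_
    have : q + (k : ℝ) ≠ 0 := by positivity
    field_simp
    ring
  have h3 : Tendsto (fun k : ℕ => Real.log (((k : ℝ) + 1) / (q + k))) atTop (𝓝 0) := by
    simpa using h1.log one_ne_zero
  refine h3.cesaro.congr fun m => ?_
  rw [Real.log_prod fun k _ => (hpos k).ne']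

theorem eventually_prod_bounds {q η : ℝ} (hq : 0 < q) (hη : 0 < η) :
    ∀ᶠ m : ℕ in atTop,
      Real.exp (-(m * η)) ≤ ∏ k ∈ Finset.range m, ((k : ℝ) + 1) / (q + k)
        ∧ ∏ k ∈ Finset.range m, ((k : ℝ) + 1) / (q + k) ≤ Real.exp (m * η) := by
  have h := tendsto_inv_mul_log_prod hq
  filter_upwards [h.eventually_const_lt (neg_lt_zero.2 hη), h.eventually_lt_const hη,
    eventually_ge_atTop 1] with m h1 h2 hm
  have hm' : (0 : ℝ) < m := by exact_mod_cast hm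
  have hpos : 0 < ∏ k ∈ Finset.range m, ((k : ℝ) + 1) / (q + k) :=
    Finset.prod_pos fun k _ => by positivity
  rw [inv_mul_eq_div, div_lt_iff₀ hm'] at h2
  rw [inv_mul_eq_div, lt_div_iff₀ hm'] at h1
  rw [← Real.le_log_iff_exp_le hpos, ← Real.log_le_iff_le_exp hpos]
  constructor <;> linarith

theorem eventually_add_one_le_exp {η : ℝ} (hη : 0 < η) :
    ∀ᶠ m : ℕ in atTop, (m : ℝ) + 1 ≤ Real.exp (m * η) := by
  filter_upwards [tendsto_natCast_atTop_atTop.eventually_ge_atTop (2 / η ^ 2)] with m hm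
  have h := Real.quadratic_le_exp_of_nonneg (show 0 ≤ m * η by positivity)
  rw [div_le_iff₀ (by positivity)] at hm
  have h0 : (0 : ℝ) ≤ m := by positivity
  have h1 : (m : ℝ) ≤ (m * η) ^ 2 / 2 := by nlinarith
  have h2 : 0 ≤ m * η := by positivity
  linarith

end Growth

/-! ### The conditional cumulant generating function and the theorem -/

section Main

open PowerSeries

variable {S Ω : Type*} [MeasurableSpace S] [MeasurableEq S] [MeasurableSpace Ω]
  {ν : Measure S} [IsProbabilityMeasure ν] {P : Measure Ω} [IsProbabilityMeasure P] {α θ : ℝ}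
  {X : ℕ → Ω → S}

theorem IsEwensPitmanSample.hasLogMGFLimit (hX : IsEwensPitmanSample α θ ν P X)
    (hν : ∀ s, ν {s} = 0) (hα : α ∈ Set.Ioo (0 : ℝ) 1) (hθ : -α < θ) {l : ℕ} (hl : 1 ≤ l)
    {n : ℕ} (hn : 1 ≤ n) {E : (ℕ → S) → Prop} (hE : PatternInvariant n E)
    (hPE : P {ω | E fun k => X k ω} ≠ 0) :
    HasLogMGFLimit α l (P[|{ω | E fun k => X k ω}])
      (fun m ω => (numBlocksWithFrequency (fun k => X k ω) (n + m) l : ℝ) / m) := by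
  have hn1 : (1 : ℝ) ≤ n := by exact_mod_cast hn
  have hq : 0 < θ + n := by linarith [hα.2]
  have hEm : MeasurableSet {ω | E fun k => X k ω} :=
    measurableSet_setOfPred.2 (hE.measurable hX.measurable)
  set A := {ω | E fun k => X k ω} with hA
  have hPE' : P A ≠ ⊤ := measure_ne_top P A
  set R : ℕ → ℝ := fun m => ∏ k ∈ Finset.range m, ((k : ℝ) + 1) / (θ + n + k) with hR
  have hR0 : ∀ m, 0 ≤ R m := fun m => Finset.prod_nonneg fun k _ => by positivity
  have key : ∀ s, 0 < s → ∀ m : ℕ, 1 ≤ m →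
      ∫⁻ ω, ENNReal.ofReal (Real.exp (m * (invLambda α l s
          * ((numBlocksWithFrequency (fun k => X k ω) (n + m) l : ℝ) / m)))) ∂(P[|A])
        = (P A)⁻¹ * (ENNReal.ofReal (R m) * ∫⁻ ω in A, ENNReal.ofReal (coeff m
          (futureSeries α θ l (Real.exp (invLambda α l s)) n fun k => X k ω)) ∂P) := by
    intro s hs m hm
    have hm' : (m : ℝ) ≠ 0 := by positivity
    rw [ProbabilityTheory.cond, lintegral_smul_measure, smul_eq_mul,
      ← hX.setLIntegral_pow hν hα hθ (Real.exp_pos _).le hn hE m]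
    congr 1
    refine lintegral_congr fun ω => ?_
    rw [← Real.exp_nat_mul]
    congr 2
    field_simp
  constructor
  · intro s hs s' hss'
    set η := (s' - s) / 4 with hη
    have hη0 : 0 < η := by linarith
    obtain ⟨C, hC⟩ := exists_coeff_futureSeries_le (S := S) (θ := θ) hα hθ hl hn hs
      (show s < s + η by linarith)
    filter_upwards [eventually_prod_bounds hq hη0, eventually_const_le_exp_mul C hη0,
      eventually_ge_atTop 1] with m hm hmC hm1
    rw [key s hs m hm1]
    have h1 : ∫⁻ ω in A, ENNReal.ofReal (coeff m
          (futureSeries α θ l (Real.exp (invLambda α l s)) n fun k => X k ω)) ∂P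
        ≤ ENNReal.ofReal (Real.exp (m * (s + 2 * η))) * P A := by
      rw [← setLIntegral_const]
      refine lintegral_mono fun ω => ENNReal.ofReal_le_ofReal ((hC _ m).trans ?_)
      calc C * Real.exp (m * (s + η)) ≤ Real.exp (m * η) * Real.exp (m * (s + η)) := by gcongr
        _ = Real.exp (m * (s + 2 * η)) := by rw [← Real.exp_add]; ring_nf
    calc (P A)⁻¹ * (ENNReal.ofReal (R m) * ∫⁻ ω in A, ENNReal.ofReal (coeff m
          (futureSeries α θ l (Real.exp (invLambda α l s)) n fun k => X k ω)) ∂P)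
        ≤ (P A)⁻¹ * (ENNReal.ofReal (Real.exp (m * η))
            * (ENNReal.ofReal (Real.exp (m * (s + 2 * η))) * P A)) := by
          gcongr
          exact hm.2
      _ = ENNReal.ofReal (Real.exp (m * η) * Real.exp (m * (s + 2 * η))) * ((P A)⁻¹ * P A) := by
          rw [ENNReal.ofReal_mul (Real.exp_pos _).le]; ring
      _ = ENNReal.ofReal (Real.exp (m * η) * Real.exp (m * (s + 2 * η))) := by
          rw [ENNReal.inv_mul_cancel hPE hPE', mul_one]
      _ ≤ ENNReal.ofReal (Real.exp (m * s')) := by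
          refine ENNReal.ofReal_le_ofReal ?_
          rw [← Real.exp_add, ← mul_add]
          refine Real.exp_le_exp.2 (mul_le_mul_of_nonneg_left ?_ (by positivity))
          linarith
  · intro s hs s' hss'
    -- a rate `r` between `max s' 0` and `s`
    set η := (s - max s' 0) / 8 with hη
    have hmax : max s' 0 < s := max_lt hss' hs
    have hη0 : 0 < η := by linarith
    have h0 := le_max_right s' 0
    have hs'le := le_max_left s' 0
    obtain ⟨κ, hκ, hC⟩ := exists_le_coeff_futureSeries (S := S) (θ := θ) hα hθ hl hn
      (show 0 < s - η by linarith) (show s - η < s by linarith)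
    filter_upwards [eventually_prod_bounds hq hη0, eventually_const_le_exp_mul κ⁻¹ hη0,
      eventually_add_one_le_exp hη0, eventually_ge_atTop 1] with m hm hmC hm2 hm1
    rw [key s hs m hm1]
    have hκ' : Real.exp (-(m * η)) ≤ κ := by
      rw [Real.exp_neg]; exact inv_le_of_inv_le₀ hκ hmC
    have h1 : ENNReal.ofReal (Real.exp (m * (s - 3 * η))) * P A
        ≤ ∫⁻ ω in A, ENNReal.ofReal (coeff m
          (futureSeries α θ l (Real.exp (invLambda α l s)) n fun k => X k ω)) ∂P := by
      rw [← setLIntegral_const]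
      refine lintegral_mono fun ω => ENNReal.ofReal_le_ofReal (le_trans ?_ (hC _ m))
      rw [le_div_iff₀ (by positivity)]
      calc Real.exp (m * (s - 3 * η)) * (m + 1)
          ≤ Real.exp (m * (s - 3 * η)) * Real.exp (m * η) := by gcongr
        _ = Real.exp (-(m * η)) * Real.exp (m * (s - η)) := by
          rw [← Real.exp_add, ← Real.exp_add]; ring_nf
        _ ≤ κ * Real.exp (m * (s - η)) := by gcongr
    calc ENNReal.ofReal (Real.exp (m * s'))
        ≤ ENNReal.ofReal (Real.exp (-(m * η)) * Real.exp (m * (s - 3 * η))) := by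
          refine ENNReal.ofReal_le_ofReal ?_
          rw [← Real.exp_add, ← mul_neg, ← mul_add]
          refine Real.exp_le_exp.2 (mul_le_mul_of_nonneg_left ?_ (by positivity))
          linarith
      _ = ENNReal.ofReal (Real.exp (-(m * η)) * Real.exp (m * (s - 3 * η)))
            * ((P A)⁻¹ * P A) := by rw [ENNReal.inv_mul_cancel hPE hPE', mul_one]
      _ = (P A)⁻¹ * (ENNReal.ofReal (Real.exp (-(m * η)))
            * (ENNReal.ofReal (Real.exp (m * (s - 3 * η))) * P A)) := by
          rw [ENNReal.ofReal_mul (Real.exp_pos _).le]; ring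
      _ ≤ _ := by
          gcongr
          exact hm.1

end Main

theorem theorem2
    {S Ω : Type*} [TopologicalSpace S] [PolishSpace S] [MeasurableSpace S] [BorelSpace S]
    [MeasurableSpace Ω]
    (ν : Measure S) [IsProbabilityMeasure ν] (hν : ∀ s : S, ν {s} = 0)
    (P : Measure Ω) [IsProbabilityMeasure P]
    (α θ : ℝ) (hα : α ∈ Set.Ioo (0 : ℝ) 1) (hθ : -α < θ)
    (X : ℕ → Ω → S) (hX : IsEwensPitmanSample α θ ν P X)
    (l : ℕ) (hl : 1 ≤ l)
    -- the initial sample: its size, its number of blocks and its block frequencies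
    (n : ℕ) (hn : 1 ≤ n) (j : ℕ) (nn : Fin j → ℕ) (hnn : ∀ i, 1 ≤ nn i) (hsum : ∑ i, nn i = n) :
    P (initialEvent X n j nn) ≠ 0 ∧
    SatisfiesLDP (P[|initialEvent X n j nn])
      (fun m ω => (numBlocksWithFrequency (fun k => X k ω) (n + m) l : ℝ) / (m : ℝ))
      (fun m => (m : ℝ)) (rateI α l) ∧
    (∀ c : ℝ, IsCompact {x : ℝ | rateI α l x ≤ (c : EReal)}) ∧
    (∀ᵐ x : ℝ, 0 < x →
      Tendsto
        (fun m : ℕ => (((m : ℝ)⁻¹ : ℝ) : EReal) * ENNReal.log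
          ((P[|initialEvent X n j nn])
            {ω | x < (numBlocksWithFrequency (fun k => X k ω) (n + m) l : ℝ) / (m : ℝ)}))
        atTop (𝓝 (-rateI α l x))) ∧
    rateI α l 0 = 0 ∧
    (∀ x ∈ Set.Ioc (0 : ℝ) (1 / (l : ℝ)), rateI α l x < ⊤) ∧
    (∀ x : ℝ, x ∉ Set.Icc (0 : ℝ) (1 / (l : ℝ)) → rateI α l x = ⊤) := by
  classical
  set E : (ℕ → S) → Prop := fun x => numBlocks x n = j ∧ blockFrequencies x n = List.ofFn nn
    with hEdef
  have hE : PatternInvariant n E := fun x y h => by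
    simp only [hEdef, h.numBlocks_eq, h.blockFrequencies_eq]
  have hEset : initialEvent X n j nn = {ω | E fun k => X k ω} := rfl
  -- a sequence that realizes the prescribed block frequencies
  have hpos : P (initialEvent X n j nn) ≠ 0 := by
    obtain ⟨b, -, hb⟩ := exists_blockFrequencies_eq (List.ofFn nn) fun r hr => by
      obtain ⟨i, rfl⟩ := List.mem_ofFn.1 hr
      exact hnn i
    rw [List.sum_ofFn, hsum] at hb
    refine fun h0 => hX.measure_samePattern_ne_zero hν hα hθ b n (measure_mono_null ?_ h0)
    intro ω hω
    have h1 := hω.blockFrequencies_eq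
    rw [hb] at h1
    refine ⟨?_, h1⟩
    rw [numBlocks_eq_length, h1, List.length_ofFn]
  have : IsProbabilityMeasure (P[|initialEvent X n j nn]) := cond_isProbabilityMeasure hpos
  have hmgf := hX.hasLogMGFLimit hν hα hθ hl hn hE (by rwa [← hEset])
  rw [← hEset] at hmgf
  have hZ : ∀ m : ℕ, Measurable fun ω =>
      (numBlocksWithFrequency (fun k => X k ω) (n + m) l : ℝ) / (m : ℝ) := fun m =>
    Measurable.div_const (measurable_from_nat.comp
      ((patternInvariant_numBlocksWithFrequency (n + m) l).measurable hX.measurable)) _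
  have hZ0 : ∀ (m : ℕ) (ω : Ω),
      0 ≤ (numBlocksWithFrequency (fun k => X k ω) (n + m) l : ℝ) / (m : ℝ) := fun m ω => by
    positivity
  refine ⟨hpos, hmgf.satisfiesLDP hZ hZ0 hα hl, isCompact_rateI_le hα hl, ?_, rateI_zero hα hl,
    fun x hx => rateI_lt_top hα hl hx.1.le hx.2, fun x hx => rateI_eq_top hα hl hx⟩
  -- the endpoint `1 / l`, where the rate function jumps, is a null set
  have hne : ∀ᵐ x : ℝ, x ≠ 1 / (l : ℝ) := by
    rw [ae_iff]
    simp
  filter_upwards [hne] with x hx hx0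
  exact hmgf.tendsto_log_measure_gt hZ hZ0 hα hl hx0 hx
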